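/- Let $N>0$ and, in Euler coordinates $r>N$, $0\le\theta<\pi$, $0\le\phi<2\pi$, $0\le\psi<4\pi$ (so that the space is $(N,\infty)\times S^3$), let $$g=f(r)^2\,dr^2+(r^2-N^2)(\sigma_1^2+\sigma_2^2)+4N^2f(r)^{-2}\sigma_3^2,$$ where $\sigma_1=\sin\psi\,d\theta-\sin\theta\cos\psi\,d\phi$, $\sigma_2=-\cos\psi\,d\theta-\sin\theta\sin\psi\,d\phi$, $\sigma_3=d\psi+\cos\theta\,d\phi$. Let $e^1=f\,dr$, $e^2=\sqrt{r^2-N^2}\,\sigma_1$, $e^3=\sqrt{r^2-N^2}\,\sigma_2$, $e^4=2Nf^{-1}\sigma_3$, with dual orthonormal frame $e_1,\dots,e_4$. Spinors are $\mathbb C^4$-valued functions with the natural Hermitian product, $e^i$ (and likewise $e_i$) acting by the matrices $$e^1=\begin{pmatrix}&&1&\\&&&1\\-1&&&\\&-1&&\end{pmatrix},\quad e^2=\begin{pmatrix}&&&i\\&&i&\\&i&&\\i&&&\end{pmatrix},\quad e^3=\begin{pmatrix}&&&-1\\&&1&\\&-1&&\\1&&&\end{pmatrix},\quad e^4=\begin{pmatrix}&&i&\\&&&-i\\i&&&\\&-i&&\end{pmatrix},$$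 and $\nabla_{e_k}\Psi=e_k(\Psi)+\frac14\sum_{i,j} g(\nabla_{e_k}e_i,e_j)\,e^i\cdot e^j\cdot\Psi$ with the Levi-Civita connection of $g$. A Rarita–Schwinger field is a smooth $\sigma=\sum_i\Psi_i\otimes e^i$ on this space with $\sum_i e^i\cdot\Psi_i=0$, $\Pi(D_{TM}\sigma)=0$ and $\sum_i(\nabla_{e_i}\sigma)(e_i)=0$, where $\nabla$ is the induced connection on spinor-valued 1-forms, $D_{TM}=\sum_j e^j\cdot\nabla_{e_j}$ and $\Pi(\sum_i\Psi_i\otimes e^i)=\sum_i\bigl(\Psi_i+\frac14 e_i\cdot\sum_j e^j\cdot\Psi_j\bigr)\otimes e^i$. It is $L^2$ if $\|\sigma\|^2=\int\sum_i|\Psi_i|^2\,d\mu_g<\infty$. Let $C_3,C_4\in\mathbb C$. (1) (Taub-NUT metric.) Let $f(r)=\sqrt{\frac{r+N}{r-N}}$ and $$u=C_3e^{-\frac i2\phi}\begin{pmatrix}0\\0\\e^{\frac i2\psi}\sin\frac\theta2\\e^{-\frac i2\psi}\cos\frac\theta2\end{pmatrix}+C_4e^{\frac i2\phi}\begin{pmatrix}0\\0\\e^{\frac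 i2\psi}\cos\frac\theta2\\-e^{-\frac i2\psi}\sin\frac\theta2\end{pmatrix}.$$ Then $u$ is a parallel spinor with $|u|^2=|C_3|^2+|C_4|^2$, and $$\sigma=\frac1{(r+N)^2}\sum_i\bigl(e^1\cdot e^4+e^2\cdot e^3\bigr)\cdot e_i\cdot u\otimes e^i$$ is an $L^2$ Rarita–Schwinger field, with $\|\sigma\|^2=128\pi^2(|C_3|^2+|C_4|^2)$. (2) (Taub-NUT metric with negative NUT charge.) Let $f(r)=\sqrt{\frac{r-N}{r+N}}$ and $$u=C_3e^{-\frac i2\phi}\begin{pmatrix}e^{\frac i2\psi}\sin\frac\theta2\\-e^{-\frac i2\psi}\cos\frac\theta2\\0\\0\end{pmatrix}+C_4e^{\frac i2\phi}\begin{pmatrix}e^{\frac i2\psi}\cos\frac\theta2\\e^{-\frac i2\psi}\sin\frac\theta2\\0\\0\end{pmatrix}.$$ Then $u$ is a parallel spinor with $|u|^2=|C_3|^2+|C_4|^2$, and $$\sigma=\frac{1}{(r-N)^{1/2}(r+N)^{5/2}}\Bigl(-2(e^1\cdot e^4+e^2\cdot e^3)\cdot u\otimes e^1+(e^2\cdot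 e^4-e^1\cdot e^3)\cdot u\otimes e^2+(e^1\cdot e^2+e^3\cdot e^4)\cdot u\otimes e^3\Bigr)$$ is an $L^2$ Rarita–Schwinger field, with $\|\sigma\|^2=\frac{32\pi^2}{N^2}(|C_3|^2+|C_4|^2)$; in particular $\|\sigma\|^2=32\pi^2/N^2$ when $|u|=1$. -/

import Mathlib

open MeasureTheory
open scoped ContDiff ENNReal Matrix

noncomputable section

namespace TaubNUT

/-- Euler coordinates `x = (r, θ, φ, ψ)`, indexed `x 0 = r`, `x 1 = θ`, `x 2 = φ`, `x 3 = ψ`;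
also the coordinate components `(v_r, v_θ, v_φ, v_ψ)` of tangent vectors. -/
abbrev Coord := Fin 4 → ℝ

/-- Spinors, as components with respect to the spin frame lifting the orthonormal frame. -/
abbrev Spinor := Fin 4 → ℂ

/-- Elements `Ψ_i ⊗ e^i` of `S_{1/2} ⊗ T*M`; the argument `i : Fin 4` stands for the frame index
`i + 1` in `1, 2, 3, 4`. -/
abbrev VectorSpinor := Fin 4 → Spinor

/-! ### The space, the metric and the orthonormal frame -/

/-- The range of the Euler coordinates away from the coordinate singularities; the angles `φ`, `ψ`
run over the whole real line, so the chart covers the space many times (see `IsSmoothSection` for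
how fields on the space are distinguished from functions on the chart). -/
def chart (N : ℝ) : Set Coord := {x | N < x 0 ∧ 0 < x 1 ∧ x 1 < Real.pi}

/-- The domain `r > N, 0 ≤ θ < π, 0 ≤ φ < 2π, 0 ≤ ψ < 4π`, over which integrals are taken. -/
def fundamentalDomain (N : ℝ) : Set Coord :=
  {x | N < x 0 ∧ (0 ≤ x 1 ∧ x 1 < Real.pi) ∧ (0 ≤ x 2 ∧ x 2 < 2 * Real.pi) ∧
    (0 ≤ x 3 ∧ x 3 < 4 * Real.pi)}

/-- The Cartesian coordinates of the point with Euler coordinates `x`. The space `r > N`, which is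
`(N, ∞) × S³`, is thereby the region `N < ‖y‖` of `ℝ⁴`. -/
def toCartesian (x : Coord) : EuclideanSpace ℝ (Fin 4) :=
  !₂[x 0 * Real.cos (x 1 / 2) * Real.cos ((x 3 + x 2) / 2),
     x 0 * Real.cos (x 1 / 2) * Real.sin ((x 3 + x 2) / 2),
     x 0 * Real.sin (x 1 / 2) * Real.cos ((x 3 - x 2) / 2),
     x 0 * Real.sin (x 1 / 2) * Real.sin ((x 3 - x 2) / 2)]

/-- The Cartan–Maurer form `σ₁`. -/
def sigma1 (x v : Coord) : ℝ := Real.sin (x 3) * v 1 - Real.sin (x 1) * Real.cos (x 3) * v 2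

/-- The Cartan–Maurer form `σ₂`. -/
def sigma2 (x v : Coord) : ℝ := -Real.cos (x 3) * v 1 - Real.sin (x 1) * Real.sin (x 3) * v 2

/-- The Cartan–Maurer form `σ₃`. -/
def sigma3 (x v : Coord) : ℝ := v 3 + Real.cos (x 1) * v 2

/-- The Taub-NUT type metric
`g = f² dr² + (r² - N²) (σ₁² + σ₂²) + 4 N² f⁻² σ₃²`. -/
def metric (N : ℝ) (f : ℝ → ℝ) (x v w : Coord) : ℝ :=
  f (x 0) ^ 2 * (v 0 * w 0)
    + ((x 0) ^ 2 - N ^ 2) * (sigma1 x v * sigma1 x w + sigma2 x v * sigma2 x w)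
    + 4 * N ^ 2 / f (x 0) ^ 2 * (sigma3 x v * sigma3 x w)

/-- The function `f` of the Taub-NUT metric. -/
def fTN (N r : ℝ) : ℝ := Real.sqrt ((r + N) / (r - N))

/-- The function `f` of the Taub-NUT metric with negative NUT charge. -/
def fNeg (N r : ℝ) : ℝ := Real.sqrt ((r - N) / (r + N))

/-- The `g`-orthonormal frame `e_1, e_2, e_3, e_4` (indexed by `0, 1, 2, 3`). -/
def frame (N : ℝ) (f : ℝ → ℝ) : Fin 4 → Coord → Coord :=
  ![fun x => ![1 / f (x 0), 0, 0, 0],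
    fun x => (1 / Real.sqrt ((x 0) ^ 2 - N ^ 2)) •
      ![0, Real.sin (x 3), -(Real.cos (x 3) / Real.sin (x 1)),
        Real.cos (x 1) * Real.cos (x 3) / Real.sin (x 1)],
    fun x => (1 / Real.sqrt ((x 0) ^ 2 - N ^ 2)) •
      ![0, -Real.cos (x 3), -(Real.sin (x 3) / Real.sin (x 1)),
        Real.cos (x 1) * Real.sin (x 3) / Real.sin (x 1)],
    fun x => ![0, 0, 0, f (x 0) / (2 * N)]]

/-! ### The Levi-Civita connection -/

/-- `g(∇_X Y, Z)` at `x` for the Levi-Civita connection of `g`, by the Koszul formula. -/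
def leviCivita (g : Coord → Coord → Coord → ℝ) (X Y Z : Coord → Coord) (x : Coord) : ℝ :=
  (1 / 2) *
    (fderiv ℝ (fun y => g y (Y y) (Z y)) x (X x)
      + fderiv ℝ (fun y => g y (Z y) (X y)) x (Y x)
      - fderiv ℝ (fun y => g y (X y) (Y y)) x (Z x)
      + g x (VectorField.lieBracket ℝ X Y x) (Z x)
      - g x (VectorField.lieBracket ℝ X Z x) (Y x)
      - g x (VectorField.lieBracket ℝ Y Z x) (X x))

/-- The connection coefficient `g(∇_{e_k} e_i, e_j)`. -/
def connCoeff (N : ℝ) (f : ℝ → ℝ) (k i j : Fin 4) (x : Coord) : ℝ :=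
  leviCivita (metric N f) (frame N f k) (frame N f i) (frame N f j) x

/-! ### Spinors, Clifford multiplication and the spin connection -/

/-- Clifford multiplication by `e^1, e^2, e^3, e^4` (indexed by `0, 1, 2, 3`). As usual `e_i` acts
on spinors in the same way as `e^i`. -/
def cl : Fin 4 → Matrix (Fin 4) (Fin 4) ℂ :=
  ![!![0, 0, 1, 0; 0, 0, 0, 1; -1, 0, 0, 0; 0, -1, 0, 0],
    !![0, 0, 0, Complex.I; 0, 0, Complex.I, 0; 0, Complex.I, 0, 0; Complex.I, 0, 0, 0],
    !![0, 0, 0, -1; 0, 0, 1, 0; 0, -1, 0, 0; 1, 0, 0, 0],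
    !![0, 0, Complex.I, 0; 0, 0, 0, -Complex.I; Complex.I, 0, 0, 0; 0, -Complex.I, 0, 0]]

/-- `|Ψ|²` for the natural Hermitian inner product on spinors. -/
def spinorNormSq (Ψ : Spinor) : ℝ := ∑ a, ‖Ψ a‖ ^ 2

/-- `|Ψ_i ⊗ e^i|² = ∑ |Ψ_i|²`. -/
def vectorSpinorNormSq (σ : VectorSpinor) : ℝ := ∑ i, spinorNormSq (σ i)

/-- Smooth fields on the whole space `r > N`: functions on the chart which are induced by a smooth
function on the region `N < ‖y‖` of `ℝ⁴`. (The forms `σ₁, σ₂, σ₃` are left-invariant on `S³`, so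
the frame `e_i` is globally defined and smooth there; hence sections of the bundles are the same as
vector valued functions on the space.) -/
def IsSmoothSection {V : Type*} [NormedAddCommGroup V] [NormedSpace ℝ V] (N : ℝ)
    (F : Coord → V) : Prop :=
  ∃ G : EuclideanSpace ℝ (Fin 4) → V,
    ContDiffOn ℝ ∞ G {y | N < ‖y‖} ∧ ∀ x ∈ chart N, F x = G (toCartesian x)

/-- The spin connection
`∇_{e_k} Ψ = e_k(Ψ) + (1/4) g(∇_{e_k} e_i, e_j) e^i · e^j · Ψ`. -/
def spinCov (N : ℝ) (f : ℝ → ℝ) (k : Fin 4) (Ψ : Coord → Spinor) (x : Coord) : Spinor :=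
  fderiv ℝ Ψ x (frame N f k x)
    + (1 / 4 : ℂ) • ∑ i, ∑ j, (connCoeff N f k i j x : ℂ) • ((cl i * cl j) *ᵥ Ψ x)

/-- `u` is a parallel spinor. -/
def IsParallelSpinor (N : ℝ) (f : ℝ → ℝ) (u : Coord → Spinor) : Prop :=
  IsSmoothSection N u ∧ ∀ x ∈ chart N, ∀ k, spinCov N f k u x = 0

/-! ### Rarita–Schwinger fields -/

/-- The value `(∇_{e_j} (Ψ_i ⊗ e^i))(e_k)` of the connection on `S_{1/2} ⊗ T*M`, where
`(∇_{e_j} e^i)(e_k) = - g(∇_{e_j} e_k, e_i)`. -/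
def vectorSpinorCov (N : ℝ) (f : ℝ → ℝ) (j k : Fin 4) (σ : Coord → VectorSpinor) (x : Coord) :
    Spinor :=
  spinCov N f j (fun y => σ y k) x - ∑ i, (connCoeff N f j k i x : ℂ) • σ x i

/-- The twisted Dirac operator `D_{TM} = e^j · ∇_{e_j}`. -/
def twistedDirac (N : ℝ) (f : ℝ → ℝ) (σ : Coord → VectorSpinor) (x : Coord) : VectorSpinor :=
  fun k => ∑ j, cl j *ᵥ vectorSpinorCov N f j k σ x

/-- The fibre of the bundle `S_{3/2}`: those `Ψ_i ⊗ e^i` with `e^i · Ψ_i = 0`. -/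
def spin32 : Set VectorSpinor := {σ | ∑ i, cl i *ᵥ σ i = 0}

/-- The projection `Π(Ψ_i ⊗ e^i) = Ψ_i ⊗ e^i + (1/4) e_i · (e^j · Ψ_j) ⊗ e^i` onto `S_{3/2}`. -/
def proj32 (σ : VectorSpinor) : VectorSpinor :=
  fun i => σ i + (1 / 4 : ℂ) • (cl i *ᵥ ∑ j, cl j *ᵥ σ j)

/-- The Rarita–Schwinger operator `Q = Π ∘ D_{TM}` (to be applied to sections of `S_{3/2}`). -/
def raritaSchwingerOp (N : ℝ) (f : ℝ → ℝ) (σ : Coord → VectorSpinor) (x : Coord) :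
    VectorSpinor :=
  proj32 (twistedDirac N f σ x)

/-- The divergence `∑_i (∇_{e_i} σ)(e_i)`. -/
def divergence (N : ℝ) (f : ℝ → ℝ) (σ : Coord → VectorSpinor) (x : Coord) : Spinor :=
  ∑ i, vectorSpinorCov N f i i σ x

/-- Rarita–Schwinger fields: smooth sections `σ` of `S_{3/2}` with `Q σ = 0` and zero divergence. -/
structure IsRaritaSchwingerField (N : ℝ) (f : ℝ → ℝ) (σ : Coord → VectorSpinor) : Prop where
  smooth : IsSmoothSection N σ
  mem_spin32 : ∀ x ∈ chart N, σ x ∈ spin32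
  operator_eq_zero : ∀ x ∈ chart N, raritaSchwingerOp N f σ x = 0
  divergence_eq_zero : ∀ x ∈ chart N, divergence N f σ x = 0

/-! ### Square integrability -/

/-- The Riemannian measure `√(det g) dr dθ dφ dψ` on the fundamental domain. -/
def riemannianMeasure (N : ℝ) (f : ℝ → ℝ) : Measure Coord :=
  (volume.restrict (fundamentalDomain N)).withDensity fun x =>
    ENNReal.ofReal (Real.sqrt
      (Matrix.of fun i j : Fin 4 => metric N f x (Pi.single i 1) (Pi.single j 1)).det)

/-- The squared `L²` norm `∫ |σ|² dμ`, with values in `[0, ∞]`. -/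
def L2NormSq (N : ℝ) (f : ℝ → ℝ) (σ : Coord → VectorSpinor) : ℝ≥0∞ :=
  ∫⁻ x, ENNReal.ofReal (vectorSpinorNormSq (σ x)) ∂(riemannianMeasure N f)

/-- `σ` is square integrable. -/
def IsL2 (N : ℝ) (f : ℝ → ℝ) (σ : Coord → VectorSpinor) : Prop :=
  AEStronglyMeasurable σ (riemannianMeasure N f) ∧ L2NormSq N f σ < ⊤

/-! ### The explicit fields -/

/-- The parallel spinor of the Taub-NUT metric with complex constants `C₃, C₄`. -/
def uTN (C₃ C₄ : ℂ) (x : Coord) : Spinor :=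
  (C₃ * Complex.exp (-(Complex.I / 2) * (x 2 : ℂ))) •
      ![0, 0,
        Complex.exp (Complex.I / 2 * (x 3 : ℂ)) * (Real.sin (x 1 / 2) : ℂ),
        Complex.exp (-(Complex.I / 2) * (x 3 : ℂ)) * (Real.cos (x 1 / 2) : ℂ)]
    + (C₄ * Complex.exp (Complex.I / 2 * (x 2 : ℂ))) •
      ![0, 0,
        Complex.exp (Complex.I / 2 * (x 3 : ℂ)) * (Real.cos (x 1 / 2) : ℂ),
        -(Complex.exp (-(Complex.I / 2) * (x 3 : ℂ)) * (Real.sin (x 1 / 2) : ℂ))]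

/-- The parallel spinor of the Taub-NUT metric with negative NUT charge, with complex constants
`C₃, C₄`. -/
def uNeg (C₃ C₄ : ℂ) (x : Coord) : Spinor :=
  (C₃ * Complex.exp (-(Complex.I / 2) * (x 2 : ℂ))) •
      ![Complex.exp (Complex.I / 2 * (x 3 : ℂ)) * (Real.sin (x 1 / 2) : ℂ),
        -(Complex.exp (-(Complex.I / 2) * (x 3 : ℂ)) * (Real.cos (x 1 / 2) : ℂ)),
        0, 0]
    + (C₄ * Complex.exp (Complex.I / 2 * (x 2 : ℂ))) •
      ![Complex.exp (Complex.I / 2 * (x 3 : ℂ)) * (Real.cos (x 1 / 2) : ℂ),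
        Complex.exp (-(Complex.I / 2) * (x 3 : ℂ)) * (Real.sin (x 1 / 2) : ℂ),
        0, 0]

/-- `σ = (r + N)⁻² (e^1·e^4 + e^2·e^3) · e_i · u ⊗ e^i`. -/
def sigmaTN (N : ℝ) (u : Coord → Spinor) (x : Coord) : VectorSpinor :=
  fun i => (((1 / (x 0 + N) ^ 2 : ℝ)) : ℂ) •
    ((cl 0 * cl 3 + cl 1 * cl 2) *ᵥ (cl i *ᵥ u x))

/-- `σ = (r - N)^{-1/2} (r + N)^{-5/2} ( -2 (e^1·e^4 + e^2·e^3) · u ⊗ e^1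
+ (e^2·e^4 - e^1·e^3) · u ⊗ e^2 + (e^1·e^2 + e^3·e^4) · u ⊗ e^3 )`. -/
def sigmaNeg (N : ℝ) (u : Coord → Spinor) (x : Coord) : VectorSpinor :=
  (((1 / ((x 0 - N) ^ (1 / 2 : ℝ) * (x 0 + N) ^ (5 / 2 : ℝ)) : ℝ)) : ℂ) •
    ![(-2 : ℂ) • ((cl 0 * cl 3 + cl 1 * cl 2) *ᵥ u x),
      (cl 1 * cl 3 - cl 0 * cl 2) *ᵥ u x,
      (cl 0 * cl 1 + cl 2 * cl 3) *ᵥ u x,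
      0]

end TaubNUT

end

noncomputable section

namespace TaubNUT

/-! Both metrics have f = (r + M) / √(r² - N²) with M = ±N, so the geometry is computed once for
both (`Profile`). The metric is cohomogeneity one: the dual fields X₁, X₂, X₃ of σ₁, σ₂, σ₃ satisfy
the su(2) relations and the frame only rescales them radially. For an orthonormal frame the Koszul
formula sees nothing but Lie brackets, and each bracket of two frame fields is a multiple of a
single frame field. All connection coefficients are therefore 1 / (√(r² - N²) (r + M)) times an
explicit function of r (`connCoeff_eq_scale_mul`), with no angles left.

The spin connection preserves the splitting ℂ² ⊕ ℂ². The components P, Q of u are coefficients of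
the spin-1/2 representation of S³, so the frame acts on (P, Q) by constant 2 × 2 matrices up to
radial factors (`fderiv_compP_frame`, `fderiv_compQ_frame`). On the lower block when M = N, and on
the upper block, after Q is replaced by -Q, when M = -N, the connection matrix cancels this action
exactly, and u is parallel.

Both fields have the form φ(r) A_i u ⊗ e^i with constant matrices A_i. Since u is parallel,
differentiating them costs one derivative of φ, one commutator of A_i with the connection matrix,
and the rotation of the coframe (`vectorSpinorCov_radialField`). The Rarita–Schwinger equations
become finite matrix identities in r, p and q (`isRaritaSchwingerField_radialField`), in which φ
enters only through l = (r² - N²) φ' / φ. It turns out that D_TM σ vanishes already before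
projection.

Finally |σ|² is radial because |P|² + |Q|² is constant, and the volume density is 2N (r² - N²) sin θ
because f cancels in the determinant. The angles contribute 16π², and the radial integrand has a
rational antiderivative (`L2NormSq_eq`). -/

/-- On the chart `f(r) = (r + M) / √(r² - N²)`, where `M = N` for the Taub-NUT metric and `M = -N`
for the one with negative NUT charge. -/
structure Profile (N M : ℝ) (f : ℝ → ℝ) : Prop where
  pos : 0 < N
  sq_eq : M ^ 2 = N ^ 2
  eq : ∀ r, N < r → f r = (r + M) / Real.sqrt (r ^ 2 - N ^ 2)

lemma profile_fTN {N : ℝ} (hN : 0 < N) : Profile N N (fTN N) := by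
  refine ⟨hN, rfl, fun r hr => ?_⟩
  have h1 : 0 < r - N := sub_pos.2 hr
  have h2 : 0 < r + N := by linarith
  rw [fTN, show (r + N) / (r - N) = (r + N) ^ 2 / (r ^ 2 - N ^ 2) by
    rw [show r ^ 2 - N ^ 2 = (r - N) * (r + N) by ring]; field_simp,
    Real.sqrt_div (by positivity), Real.sqrt_sq h2.le]

lemma profile_fNeg {N : ℝ} (hN : 0 < N) : Profile N (-N) (fNeg N) := by
  refine ⟨hN, by ring, fun r hr => ?_⟩
  have h1 : 0 < r - N := sub_pos.2 hr
  have h2 : 0 < r + N := by linarith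
  rw [fNeg, show (r - N) / (r + N) = (r - N) ^ 2 / (r ^ 2 - N ^ 2) by
    rw [show r ^ 2 - N ^ 2 = (r - N) * (r + N) by ring]; field_simp,
    Real.sqrt_div (by positivity), Real.sqrt_sq h1.le, sub_eq_add_neg]

namespace Profile

variable {N M : ℝ} {f : ℝ → ℝ} {r : ℝ}

lemma add_pos (h : Profile N M f) (hr : N < r) : 0 < r + M := by
  have := h.pos
  rcases sq_eq_sq_iff_eq_or_eq_neg.1 h.sq_eq with rfl | rfl <;> linarith

lemma sub_pos (h : Profile N M f) (hr : N < r) : 0 < r ^ 2 - N ^ 2 := by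
  have := h.pos
  nlinarith

lemma f_pos (h : Profile N M f) (hr : N < r) : 0 < f r := by
  rw [h.eq r hr]
  exact div_pos (h.add_pos hr) (Real.sqrt_pos.2 (h.sub_pos hr))

end Profile

lemma hasDerivAt_sqrt_sub {N r : ℝ} (h : 0 < r ^ 2 - N ^ 2) :
    HasDerivAt (fun s => Real.sqrt (s ^ 2 - N ^ 2)) (r / Real.sqrt (r ^ 2 - N ^ 2)) r := by
  have := (((hasDerivAt_id r).pow 2).sub_const (N ^ 2)).sqrt h.ne'
  refine this.congr_deriv ?_
  simp
  field_simp

lemma hasDerivAt_one_div_sqrt_sub {N r : ℝ} (h : 0 < r ^ 2 - N ^ 2) :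
    HasDerivAt (fun s => 1 / Real.sqrt (s ^ 2 - N ^ 2))
      (-r / Real.sqrt (r ^ 2 - N ^ 2) ^ 3) r := by
  have h0 := Real.sqrt_pos.2 h
  have := (hasDerivAt_sqrt_sub h).inv h0.ne'
  simp only [one_div]
  refine this.congr_deriv ?_
  field_simp

lemma Profile.hasDerivAt {N M : ℝ} {f : ℝ → ℝ} {r : ℝ} (h : Profile N M f) (hr : N < r) :
    HasDerivAt f (-M / (Real.sqrt (r ^ 2 - N ^ 2) * (r - M))) r := by
  have h0 := h.sub_pos hr
  have h1 := Real.sqrt_pos.2 h0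
  have h2 := h.add_pos hr
  -- The quotient rule gives numerator -N² - M r = -M (r + M); one factor r + M then cancels against
  -- r² - N² = (r - M)(r + M).
  have h4 : (r - M) * (r + M) = r ^ 2 - N ^ 2 := by linear_combination -h.sq_eq
  have h3 : 0 < r - M := by
    by_contra! h3
    nlinarith
  have h5 := Real.sq_sqrt h0.le
  have := ((hasDerivAt_id r).add_const M).div (hasDerivAt_sqrt_sub h0) h1.ne'
  refine (this.congr_of_eventuallyEq ?_).congr_deriv ?_
  · filter_upwards [lt_mem_nhds hr] with s hs
    simp [h.eq s hs]
  · simp only [id]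
    field_simp
    rw [h5]
    linear_combination r * h.sq_eq

/-! ### Orthonormality of the frame and the Koszul formula -/

lemma isOpen_chart (N : ℝ) : IsOpen (chart N) := by
  refine (isOpen_lt continuous_const (continuous_apply 0)).inter
    ((isOpen_lt continuous_const (continuous_apply 1)).inter
      (isOpen_lt (continuous_apply 1) continuous_const))

lemma sin_pos_of_mem_chart {N : ℝ} {x : Coord} (hx : x ∈ chart N) : 0 < Real.sin (x 1) :=
  Real.sin_pos_of_pos_of_lt_pi hx.2.1 hx.2.2

/-- The dual coframe expressed through the metric: `g(v, e_j)`. -/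
lemma metric_frame {N M : ℝ} {f : ℝ → ℝ} (h : Profile N M f) {x : Coord} (hx : x ∈ chart N)
    (v : Coord) (j : Fin 4) :
    metric N f x v (frame N f j x) =
      ![f (x 0) * v 0, Real.sqrt (x 0 ^ 2 - N ^ 2) * sigma1 x v,
        Real.sqrt (x 0 ^ 2 - N ^ 2) * sigma2 x v, 2 * N / f (x 0) * sigma3 x v] j := by
  have hN := h.pos
  have h0 := h.sub_pos hx.1
  have h1 := Real.sqrt_pos.2 h0
  have h2 := h.f_pos hx.1
  have h3 := sin_pos_of_mem_chart hx
  have h5 : x 0 ^ 2 - N ^ 2 = Real.sqrt (x 0 ^ 2 - N ^ 2) ^ 2 := (Real.sq_sqrt h0.le).symm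
  have h6 := Real.sin_sq_add_cos_sq (x 3)
  generalize ha : Real.sqrt (x 0 ^ 2 - N ^ 2) = a at *
  unfold metric
  rw [h5]
  fin_cases j <;> simp [frame, sigma1, sigma2, sigma3, ha] <;> field_simp
  · linear_combination a ^ 2 * f (x 0) ^ 2 * Real.sin (x 1) *
      (Real.sin (x 3) * v 1 - Real.sin (x 1) * Real.cos (x 3) * v 2) * h6
  · linear_combination a ^ 2 * f (x 0) ^ 2 * Real.sin (x 1) *
      (-(Real.cos (x 3) * v 1) - Real.sin (x 1) * Real.sin (x 3) * v 2) * h6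
  · ring

lemma metric_frame_frame {N M : ℝ} {f : ℝ → ℝ} (h : Profile N M f) {x : Coord}
    (hx : x ∈ chart N) (i j : Fin 4) :
    metric N f x (frame N f i x) (frame N f j x) = if i = j then 1 else 0 := by
  have hN := h.pos
  have h1 := Real.sqrt_pos.2 (h.sub_pos hx.1)
  have h2 := h.f_pos hx.1
  have h3 := sin_pos_of_mem_chart hx
  have h6 := Real.sin_sq_add_cos_sq (x 3)
  rw [metric_frame h hx]
  fin_cases i <;> fin_cases j <;> simp [frame, sigma1, sigma2, sigma3] <;> field_simp <;>
    first | linear_combination h6 | ring1 | (right; ring1)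

/-- For an orthonormal frame the Koszul formula only involves Lie brackets. -/
lemma connCoeff_eq {N M : ℝ} {f : ℝ → ℝ} (h : Profile N M f) {x : Coord}
    (hx : x ∈ chart N) (k i j : Fin 4) :
    connCoeff N f k i j x = (1 / 2) *
      (metric N f x (VectorField.lieBracket ℝ (frame N f k) (frame N f i) x) (frame N f j x)
      - metric N f x (VectorField.lieBracket ℝ (frame N f k) (frame N f j) x) (frame N f i x)
      - metric N f x (VectorField.lieBracket ℝ (frame N f i) (frame N f j) x)
          (frame N f k x)) := by
  -- The pairings of frame fields are constant on the open chart, so the three derivative terms of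
  -- the Koszul formula vanish.
  have key : ∀ a b : Fin 4,
      fderiv ℝ (fun y => metric N f y (frame N f a y) (frame N f b y)) x = 0 := by
    intro a b
    have : (fun y => metric N f y (frame N f a y) (frame N f b y)) =ᶠ[nhds x]
        fun _ => if a = b then 1 else 0 := by
      filter_upwards [(isOpen_chart N).mem_nhds hx] with y hy
      exact metric_frame_frame h hy a b
    rw [this.fderiv_eq]
    simp
  simp only [connCoeff, leviCivita, key]
  simp

/-! ### Derivatives of the frame fields -/

lemma hasFDerivAt_comp_coord {E : Type*} [NormedAddCommGroup E] [NormedSpace ℝ E] {φ : ℝ → E}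
    {φ' : E} {x : Coord} (i : Fin 4) (h : HasDerivAt φ φ' (x i)) :
    HasFDerivAt (fun y : Coord => φ (y i))
      ((ContinuousLinearMap.toSpanSingleton ℝ φ').comp
        (ContinuousLinearMap.proj (R := ℝ) (φ := fun _ : Fin 4 => ℝ) i)) x :=
  HasFDerivAt.comp x (f := fun y : Coord => y i) h.hasFDerivAt (hasFDerivAt_apply i x)

lemma fderiv_mul_mul {p q s : ℝ → ℝ} {p' q' s' : ℝ} {x : Coord}
    (hp : HasDerivAt p p' (x 0)) (hq : HasDerivAt q q' (x 1)) (hs : HasDerivAt s s' (x 3))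
    (v : Coord) :
    DifferentiableAt ℝ (fun y : Coord => p (y 0) * (q (y 1) * s (y 3))) x ∧
    fderiv ℝ (fun y : Coord => p (y 0) * (q (y 1) * s (y 3))) x v =
      p' * v 0 * (q (x 1) * s (x 3)) + p (x 0) * (q' * v 1 * s (x 3) + q (x 1) * (s' * v 3)) := by
  have := (hasFDerivAt_comp_coord 0 hp).mul
    ((hasFDerivAt_comp_coord 1 hq).mul (hasFDerivAt_comp_coord 3 hs))
  refine ⟨this.differentiableAt, ?_⟩
  refine (congrArg (· v) this.fderiv).trans ?_
  simp
  ring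

/-- Derivative of a vector field whose components are products of functions of `r`, `θ`, `ψ`. -/
lemma fderiv_field {p q s : Fin 4 → ℝ → ℝ} {p' q' s' : Fin 4 → ℝ} {x : Coord}
    {X : Coord → Coord} (hX : ∀ y c, X y c = p c (y 0) * (q c (y 1) * s c (y 3)))
    (hp : ∀ c, HasDerivAt (p c) (p' c) (x 0)) (hq : ∀ c, HasDerivAt (q c) (q' c) (x 1))
    (hs : ∀ c, HasDerivAt (s c) (s' c) (x 3)) (v : Coord) (c : Fin 4) :
    fderiv ℝ X x v c = p' c * v 0 * (q c (x 1) * s c (x 3)) +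
      p c (x 0) * (q' c * v 1 * s c (x 3) + q c (x 1) * (s' c * v 3)) := by
  have : X = fun y c => p c (y 0) * (q c (y 1) * s c (y 3)) := by
    ext y c
    exact hX y c
  rw [this, fderiv_pi fun c => (fderiv_mul_mul (hp c) (hq c) (hs c) v).1]
  exact (fderiv_mul_mul (hp c) (hq c) (hs c) v).2

section FrameDerivatives

variable {N M : ℝ} {f : ℝ → ℝ} {x : Coord}

lemma fderiv_frame_zero (h : Profile N M f) (hx : x ∈ chart N) (v : Coord) :
    fderiv ℝ (frame N f 0) x v =
      ![M / (Real.sqrt (x 0 ^ 2 - N ^ 2) * (x 0 - M)) / f (x 0) ^ 2 * v 0, 0, 0, 0] := by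
  have h2 := h.f_pos hx.1
  have hd : HasDerivAt (fun r => 1 / f r)
      (M / (Real.sqrt (x 0 ^ 2 - N ^ 2) * (x 0 - M)) / f (x 0) ^ 2) (x 0) := by
    simp only [one_div]
    refine ((h.hasDerivAt hx.1).inv h2.ne').congr_deriv ?_
    ring
  ext c
  rw [fderiv_field (p := ![fun r => 1 / f r, fun _ => 0, fun _ => 0, fun _ => 0])
    (p' := ![M / (Real.sqrt (x 0 ^ 2 - N ^ 2) * (x 0 - M)) / f (x 0) ^ 2, 0, 0, 0])
    (q := fun _ _ => 1) (q' := fun _ => 0) (s := fun _ _ => 1) (s' := fun _ => 0)]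
  · fin_cases c <;> simp
  · intro y c
    fin_cases c <;> simp [frame]
  · intro c
    fin_cases c
    · exact hd
    all_goals exact hasDerivAt_const _ _
  · exact fun c => hasDerivAt_const _ _
  · exact fun c => hasDerivAt_const _ _

lemma fderiv_frame_three (h : Profile N M f) (hx : x ∈ chart N) (v : Coord) :
    fderiv ℝ (frame N f 3) x v =
      ![0, 0, 0, -M / (Real.sqrt (x 0 ^ 2 - N ^ 2) * (x 0 - M)) / (2 * N) * v 0] := by
  ext c
  rw [fderiv_field (p := ![fun _ => 0, fun _ => 0, fun _ => 0, fun r => f r / (2 * N)])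
    (p' := ![0, 0, 0, -M / (Real.sqrt (x 0 ^ 2 - N ^ 2) * (x 0 - M)) / (2 * N)])
    (q := fun _ _ => 1) (q' := fun _ => 0) (s := fun _ _ => 1) (s' := fun _ => 0)]
  · fin_cases c <;> simp
  · intro y c
    fin_cases c <;> simp [frame]
  · intro c
    fin_cases c
    · exact hasDerivAt_const _ _
    · exact hasDerivAt_const _ _
    · exact hasDerivAt_const _ _
    · exact (h.hasDerivAt hx.1).div_const _
  · exact fun c => hasDerivAt_const _ _
  · exact fun c => hasDerivAt_const _ _

lemma hasDerivAt_inv_sin {t : ℝ} (h : Real.sin t ≠ 0) :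
    HasDerivAt (fun t => (Real.sin t)⁻¹) (-Real.cos t / Real.sin t ^ 2) t :=
  (Real.hasDerivAt_sin t).inv h

lemma hasDerivAt_cot {t : ℝ} (h : Real.sin t ≠ 0) :
    HasDerivAt (fun t => Real.cos t / Real.sin t) (-1 / Real.sin t ^ 2) t := by
  refine ((Real.hasDerivAt_cos t).div (Real.hasDerivAt_sin t) h).congr_deriv ?_
  congr 1
  linear_combination -Real.sin_sq_add_cos_sq t

lemma fderiv_frame_one (h : Profile N M f) (hx : x ∈ chart N) (v : Coord) :
    fderiv ℝ (frame N f 1) x v =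
      (-x 0 / Real.sqrt (x 0 ^ 2 - N ^ 2) ^ 3 * v 0) •
        ![0, Real.sin (x 3), -(Real.cos (x 3) / Real.sin (x 1)),
          Real.cos (x 1) * Real.cos (x 3) / Real.sin (x 1)] +
      (1 / Real.sqrt (x 0 ^ 2 - N ^ 2)) •
        ![0, Real.cos (x 3) * v 3,
          Real.cos (x 1) / Real.sin (x 1) ^ 2 * v 1 * Real.cos (x 3)
            + (Real.sin (x 1))⁻¹ * (Real.sin (x 3) * v 3),
          -1 / Real.sin (x 1) ^ 2 * v 1 * Real.cos (x 3)
            - Real.cos (x 1) / Real.sin (x 1) * (Real.sin (x 3) * v 3)] := by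
  have h3 := (sin_pos_of_mem_chart hx).ne'
  ext c
  rw [fderiv_field (p := fun _ r => 1 / Real.sqrt (r ^ 2 - N ^ 2))
    (p' := fun _ => -x 0 / Real.sqrt (x 0 ^ 2 - N ^ 2) ^ 3)
    (q := ![fun _ => 0, fun _ => 1, fun t => (Real.sin t)⁻¹, fun t => Real.cos t / Real.sin t])
    (q' := ![0, 0, -Real.cos (x 1) / Real.sin (x 1) ^ 2, -1 / Real.sin (x 1) ^ 2])
    (s := ![fun _ => 0, Real.sin, fun t => -Real.cos t, Real.cos])
    (s' := ![0, Real.cos (x 3), Real.sin (x 3), -Real.sin (x 3)])]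
  · fin_cases c <;> simp <;> ring
  · intro y c
    fin_cases c <;> simp [frame] <;> first | ring1 | (left; ring1)
  · exact fun c => hasDerivAt_one_div_sqrt_sub (h.sub_pos hx.1)
  · intro c
    fin_cases c
    · exact hasDerivAt_const _ _
    · exact hasDerivAt_const _ _
    · exact hasDerivAt_inv_sin h3
    · exact hasDerivAt_cot h3
  · intro c
    fin_cases c
    · exact hasDerivAt_const _ _
    · exact Real.hasDerivAt_sin _
    · exact (Real.hasDerivAt_cos _).neg.congr_deriv (neg_neg _)
    · exact Real.hasDerivAt_cos _

lemma fderiv_frame_two (h : Profile N M f) (hx : x ∈ chart N) (v : Coord) :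
    fderiv ℝ (frame N f 2) x v =
      (-x 0 / Real.sqrt (x 0 ^ 2 - N ^ 2) ^ 3 * v 0) •
        ![0, -Real.cos (x 3), -(Real.sin (x 3) / Real.sin (x 1)),
          Real.cos (x 1) * Real.sin (x 3) / Real.sin (x 1)] +
      (1 / Real.sqrt (x 0 ^ 2 - N ^ 2)) •
        ![0, Real.sin (x 3) * v 3,
          Real.cos (x 1) / Real.sin (x 1) ^ 2 * v 1 * Real.sin (x 3)
            - (Real.sin (x 1))⁻¹ * (Real.cos (x 3) * v 3),
          -1 / Real.sin (x 1) ^ 2 * v 1 * Real.sin (x 3)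
            + Real.cos (x 1) / Real.sin (x 1) * (Real.cos (x 3) * v 3)] := by
  have h3 := (sin_pos_of_mem_chart hx).ne'
  ext c
  rw [fderiv_field (p := fun _ r => 1 / Real.sqrt (r ^ 2 - N ^ 2))
    (p' := fun _ => -x 0 / Real.sqrt (x 0 ^ 2 - N ^ 2) ^ 3)
    (q := ![fun _ => 0, fun _ => 1, fun t => (Real.sin t)⁻¹, fun t => Real.cos t / Real.sin t])
    (q' := ![0, 0, -Real.cos (x 1) / Real.sin (x 1) ^ 2, -1 / Real.sin (x 1) ^ 2])
    (s := ![fun _ => 0, fun t => -Real.cos t, fun t => -Real.sin t, Real.sin])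
    (s' := ![0, Real.sin (x 3), -Real.cos (x 3), Real.cos (x 3)])]
  · fin_cases c <;> simp <;> first | ring1 | (left; ring1)
  · intro y c
    fin_cases c <;> simp [frame] <;> first | ring1 | (left; ring1)
  · exact fun c => hasDerivAt_one_div_sqrt_sub (h.sub_pos hx.1)
  · intro c
    fin_cases c
    · exact hasDerivAt_const _ _
    · exact hasDerivAt_const _ _
    · exact hasDerivAt_inv_sin h3
    · exact hasDerivAt_cot h3
  · intro c
    fin_cases c
    · exact hasDerivAt_const _ _
    · exact (Real.hasDerivAt_cos _).neg.congr_deriv (neg_neg _)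
    · exact (Real.hasDerivAt_sin _).neg
    · exact Real.hasDerivAt_sin _

end FrameDerivatives

/-! ### Lie brackets and connection coefficients -/

section Connection

variable {N M : ℝ} {f : ℝ → ℝ} {x : Coord}

/-- The scale `1 / (r + M) √(r² - N²)` common to all the structure constants of the frame. -/
def scale (N M r : ℝ) : ℝ := 1 / (Real.sqrt (r ^ 2 - N ^ 2) * (r + M))

/-- Only the radial normalisation 1 / √(r² - N²) of the second field is differentiated; the
direction of that field does not depend on r. -/
lemma lieBracket_frame_zero_one (h : Profile N M f) (hx : x ∈ chart N) :
    VectorField.lieBracket ℝ (frame N f 0) (frame N f 1) x =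
      (scale N M (x 0) * -x 0) • frame N f 1 x := by
  have h1 := Real.sqrt_pos.2 (h.sub_pos hx.1)
  have h2 := h.add_pos hx.1
  rw [VectorField.lieBracket, fderiv_frame_one h hx, fderiv_frame_zero h hx]
  ext c
  fin_cases c <;> simp [frame, scale, h.eq _ hx.1] <;> field_simp

lemma lieBracket_frame_zero_two (h : Profile N M f) (hx : x ∈ chart N) :
    VectorField.lieBracket ℝ (frame N f 0) (frame N f 2) x =
      (scale N M (x 0) * -x 0) • frame N f 2 x := by
  have h1 := Real.sqrt_pos.2 (h.sub_pos hx.1)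
  have h2 := h.add_pos hx.1
  rw [VectorField.lieBracket, fderiv_frame_two h hx, fderiv_frame_zero h hx]
  ext c
  fin_cases c <;> simp [frame, scale, h.eq _ hx.1] <;> field_simp

/-- Here the radial factor is f / (2N), so M enters through f'. -/
lemma lieBracket_frame_zero_three (h : Profile N M f) (hx : x ∈ chart N) :
    VectorField.lieBracket ℝ (frame N f 0) (frame N f 3) x =
      (scale N M (x 0) * -M) • frame N f 3 x := by
  have hN := h.pos
  have h0 := h.sub_pos hx.1
  have h1 := Real.sqrt_pos.2 h0
  have h2 := h.add_pos hx.1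
  have h4 : (x 0 - M) * (x 0 + M) = x 0 ^ 2 - N ^ 2 := by linear_combination -h.sq_eq
  have h3 : x 0 - M ≠ 0 := by
    intro h3
    rw [h3] at h4
    linarith
  have h5 := Real.sq_sqrt h0.le
  rw [VectorField.lieBracket, fderiv_frame_three h hx, fderiv_frame_zero h hx]
  ext c
  fin_cases c <;> simp [frame, scale, h.eq _ hx.1]
  field_simp
  linear_combination M * h4 - M * h5

/-- This is the su(2) relation [X₁, X₂] = -X₃ divided by r² - N²; the coefficient -2N comes from
rewriting X₃ as (2N / f) e₄. -/
lemma lieBracket_frame_one_two (h : Profile N M f) (hx : x ∈ chart N) :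
    VectorField.lieBracket ℝ (frame N f 1) (frame N f 2) x =
      (scale N M (x 0) * (-2 * N)) • frame N f 3 x := by
  have hN := h.pos
  have h1 := Real.sqrt_pos.2 (h.sub_pos hx.1)
  have h2 := h.add_pos hx.1
  have h3 := sin_pos_of_mem_chart hx
  have h6 := Real.sin_sq_add_cos_sq (x 3)
  have h7 := Real.sin_sq_add_cos_sq (x 1)
  rw [VectorField.lieBracket, fderiv_frame_one h hx, fderiv_frame_two h hx]
  ext c
  fin_cases c <;> simp [frame, scale, h.eq _ hx.1] <;> field_simp
  · ring
  · ring
  · linear_combination (Real.cos (x 1) ^ 2 - 1) * h6 + h7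

lemma lieBracket_frame_two_three (h : Profile N M f) (hx : x ∈ chart N) :
    VectorField.lieBracket ℝ (frame N f 2) (frame N f 3) x =
      (scale N M (x 0) * (-(x 0 + M) ^ 2 / (2 * N))) • frame N f 1 x := by
  have hN := h.pos
  have h1 := Real.sqrt_pos.2 (h.sub_pos hx.1)
  have h2 := h.add_pos hx.1
  have h3 := sin_pos_of_mem_chart hx
  rw [VectorField.lieBracket, fderiv_frame_two h hx, fderiv_frame_three h hx]
  ext c
  fin_cases c <;> simp [frame, scale, h.eq _ hx.1] <;> field_simp

lemma lieBracket_frame_one_three (h : Profile N M f) (hx : x ∈ chart N) :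
    VectorField.lieBracket ℝ (frame N f 1) (frame N f 3) x =
      (scale N M (x 0) * ((x 0 + M) ^ 2 / (2 * N))) • frame N f 2 x := by
  have hN := h.pos
  have h1 := Real.sqrt_pos.2 (h.sub_pos hx.1)
  have h2 := h.add_pos hx.1
  have h3 := sin_pos_of_mem_chart hx
  rw [VectorField.lieBracket, fderiv_frame_one h hx, fderiv_frame_three h hx]
  ext c
  fin_cases c <;> simp [frame, scale, h.eq _ hx.1] <;> field_simp

lemma metric_smul_left (N : ℝ) (f : ℝ → ℝ) (x : Coord) (c : ℝ) (v w : Coord) :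
    metric N f x (c • v) w = c * metric N f x v w := by
  simp [metric, sigma1, sigma2, sigma3]
  ring

/-- `g(∇_{e_k} e_i, e_j)` up to the common factor `scale`. -/
def connTable (N M r : ℝ) : Fin 4 → Matrix (Fin 4) (Fin 4) ℝ :=
  ![0,
    !![0, r, 0, 0; -r, 0, 0, 0; 0, 0, 0, -N; 0, 0, N, 0],
    !![0, 0, r, 0; 0, 0, 0, N; -r, 0, 0, 0; 0, -N, 0, 0],
    !![0, 0, 0, M; 0, 0, N - (r + M) ^ 2 / (2 * N), 0;
      0, -(N - (r + M) ^ 2 / (2 * N)), 0, 0; -M, 0, 0, 0]]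

lemma connCoeff_eq_scale_mul (h : Profile N M f) (hx : x ∈ chart N) (k i j : Fin 4) :
    connCoeff N f k i j x = scale N M (x 0) * connTable N M (x 0) k i j := by
  have e := metric_frame_frame h hx
  have s : ∀ i j k, metric N f x (VectorField.lieBracket ℝ (frame N f i) (frame N f j) x)
      (frame N f k x) =
      -metric N f x (VectorField.lieBracket ℝ (frame N f j) (frame N f i) x)
        (frame N f k x) := by
    intro i j k
    rw [VectorField.lieBracket_swap, ← neg_one_smul ℝ, metric_smul_left, neg_one_mul]
  have z : ∀ i k, metric N f x (VectorField.lieBracket ℝ (frame N f i) (frame N f i) x)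
      (frame N f k x) = 0 := by
    intro i k
    linarith [s i i k]
  -- The table of structure constants, needed only for i ≤ j; antisymmetry of the bracket supplies
  -- the other half.
  have b : ∀ i j : Fin 4, i ≤ j → ∀ k : Fin 4,
      metric N f x (VectorField.lieBracket ℝ (frame N f i) (frame N f j) x) (frame N f k x) =
        scale N M (x 0) *
          (![![0, ![0, -x 0, 0, 0], ![0, 0, -x 0, 0], ![0, 0, 0, -M]],
            ![0, 0, ![0, 0, 0, -2 * N], ![0, 0, (x 0 + M) ^ 2 / (2 * N), 0]],
            ![0, 0, 0, ![0, -(x 0 + M) ^ 2 / (2 * N), 0, 0]],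
            0] : Fin 4 → Fin 4 → Fin 4 → ℝ) i j k := by
    intro i j hij k
    fin_cases i <;> fin_cases j <;> simp at hij <;>
      simp only [Fin.zero_eta, Fin.mk_one, Fin.reduceFinMk, z,
        lieBracket_frame_zero_one h hx, lieBracket_frame_zero_two h hx,
        lieBracket_frame_zero_three h hx, lieBracket_frame_one_two h hx,
        lieBracket_frame_two_three h hx, lieBracket_frame_one_three h hx,
        metric_smul_left, e] <;>
      fin_cases k <;> simp
  have t : ∀ i j : Fin 4, j < i → ∀ k : Fin 4, _ :=
    fun i j hij k => (s i j k).trans (congrArg Neg.neg (b j i hij.le k))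
  rw [connCoeff_eq h hx]
  fin_cases k <;> fin_cases i <;> fin_cases j <;>
    simp (disch := decide) only [Fin.zero_eta, Fin.mk_one, Fin.reduceFinMk, z, b, t] <;>
    simp [connTable] <;> ring

end Connection

/-! ### The components of the parallel spinors -/

/-- The first nonzero component of the parallel spinors. -/
def compP (C₃ C₄ : ℂ) (x : Coord) : ℂ :=
  C₃ * Complex.exp (-(Complex.I / 2) * (x 2 : ℂ)) *
      (Complex.exp (Complex.I / 2 * (x 3 : ℂ)) * (Real.sin (x 1 / 2) : ℂ))
    + C₄ * Complex.exp (Complex.I / 2 * (x 2 : ℂ)) *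
      (Complex.exp (Complex.I / 2 * (x 3 : ℂ)) * (Real.cos (x 1 / 2) : ℂ))

/-- The second nonzero component of the parallel spinors (up to sign). -/
def compQ (C₃ C₄ : ℂ) (x : Coord) : ℂ :=
  C₃ * Complex.exp (-(Complex.I / 2) * (x 2 : ℂ)) *
      (Complex.exp (-(Complex.I / 2) * (x 3 : ℂ)) * (Real.cos (x 1 / 2) : ℂ))
    + C₄ * Complex.exp (Complex.I / 2 * (x 2 : ℂ)) *
      (Complex.exp (-(Complex.I / 2) * (x 3 : ℂ)) * ((-Real.sin (x 1 / 2) : ℝ) : ℂ))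

lemma uTN_eq (C₃ C₄ : ℂ) (x : Coord) : uTN C₃ C₄ x = ![0, 0, compP C₃ C₄ x, compQ C₃ C₄ x] := by
  ext c
  fin_cases c <;> simp [uTN, compP, compQ]

lemma uNeg_eq (C₃ C₄ : ℂ) (x : Coord) :
    uNeg C₃ C₄ x = ![compP C₃ C₄ x, -compQ C₃ C₄ x, 0, 0] := by
  ext c
  fin_cases c <;> simp [uNeg, compP, compQ]
  ring

/-- All four terms making up P and Q have this shape; the minus sign in `compQ` is kept inside the
real function of θ for this reason. -/
lemma fderiv_exp_mul (C c₂ c₃ : ℂ) {g : ℝ → ℝ} {g' : ℝ} {x : Coord}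
    (hg : HasDerivAt g g' (x 1)) (v : Coord) :
    DifferentiableAt ℝ (fun y : Coord => C * Complex.exp (c₂ * (y 2 : ℂ)) *
      (Complex.exp (c₃ * (y 3 : ℂ)) * (g (y 1) : ℂ))) x ∧
    fderiv ℝ (fun y : Coord => C * Complex.exp (c₂ * (y 2 : ℂ)) *
      (Complex.exp (c₃ * (y 3 : ℂ)) * (g (y 1) : ℂ))) x v =
      C * Complex.exp (c₂ * (x 2 : ℂ)) * Complex.exp (c₃ * (x 3 : ℂ)) *
        ((c₂ * v 2 + c₃ * v 3) * g (x 1) + g' * v 1) := by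
  have he : ∀ (c : ℂ) (t : ℝ), HasDerivAt (fun t : ℝ => Complex.exp (c * (t : ℂ)))
      (Complex.exp (c * (t : ℂ)) * c) t := by
    intro c t
    have := ((hasDerivAt_id (t : ℂ)).const_mul c).cexp.comp_ofReal
    simpa using this
  have := ((hasFDerivAt_comp_coord 2 (he c₂ (x 2))).const_mul C).mul
    ((hasFDerivAt_comp_coord 3 (he c₃ (x 3))).mul (hasFDerivAt_comp_coord 1 hg.ofReal_comp))
  refine ⟨this.differentiableAt, ?_⟩
  refine (congrArg (· v) this.fderiv).trans ?_
  simp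
  ring

section ComponentDerivatives

variable (C₃ C₄ : ℂ) (x : Coord)

lemma hasDerivAt_sin_half (t : ℝ) :
    HasDerivAt (fun t => Real.sin (t / 2)) (Real.cos (t / 2) / 2) t := by
  simpa [div_eq_mul_inv] using ((hasDerivAt_id t).div_const 2).sin

lemma hasDerivAt_cos_half (t : ℝ) :
    HasDerivAt (fun t => Real.cos (t / 2)) (-Real.sin (t / 2) / 2) t := by
  simpa [div_eq_mul_inv] using ((hasDerivAt_id t).div_const 2).cos

lemma hasDerivAt_neg_sin_half (t : ℝ) :
    HasDerivAt (fun t => -Real.sin (t / 2)) (-(Real.cos (t / 2) / 2)) t :=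
  (hasDerivAt_sin_half t).neg

lemma differentiableAt_compP : DifferentiableAt ℝ (compP C₃ C₄) x :=
  (fderiv_exp_mul C₃ _ _ (hasDerivAt_sin_half (x 1)) 0).1.add
    (fderiv_exp_mul C₄ _ _ (hasDerivAt_cos_half (x 1)) 0).1

lemma differentiableAt_compQ : DifferentiableAt ℝ (compQ C₃ C₄) x :=
  (fderiv_exp_mul C₃ _ _ (hasDerivAt_cos_half (x 1)) 0).1.add
    (fderiv_exp_mul C₄ _ _ (hasDerivAt_neg_sin_half (x 1)) 0).1

lemma fderiv_compP (v : Coord) : fderiv ℝ (compP C₃ C₄) x v =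
    C₃ * Complex.exp (-(Complex.I / 2) * (x 2 : ℂ)) * Complex.exp (Complex.I / 2 * (x 3 : ℂ)) *
      ((-(Complex.I / 2) * v 2 + Complex.I / 2 * v 3) * (Real.sin (x 1 / 2) : ℝ)
        + (Real.cos (x 1 / 2) / 2 : ℝ) * v 1)
    + C₄ * Complex.exp (Complex.I / 2 * (x 2 : ℂ)) * Complex.exp (Complex.I / 2 * (x 3 : ℂ)) *
      ((Complex.I / 2 * v 2 + Complex.I / 2 * v 3) * (Real.cos (x 1 / 2) : ℝ)
        + (-Real.sin (x 1 / 2) / 2 : ℝ) * v 1) := by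
  have h1 := fderiv_exp_mul C₃ (-(Complex.I / 2)) (Complex.I / 2) (hasDerivAt_sin_half (x 1)) v
  have h2 := fderiv_exp_mul C₄ (Complex.I / 2) (Complex.I / 2) (hasDerivAt_cos_half (x 1)) v
  rw [← h1.2, ← h2.2]
  exact congrArg (· v) (fderiv_add h1.1 h2.1)

lemma fderiv_compQ (v : Coord) : fderiv ℝ (compQ C₃ C₄) x v =
    C₃ * Complex.exp (-(Complex.I / 2) * (x 2 : ℂ)) * Complex.exp (-(Complex.I / 2) * (x 3 : ℂ)) *
      ((-(Complex.I / 2) * v 2 + -(Complex.I / 2) * v 3) * (Real.cos (x 1 / 2) : ℝ)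
        + (-Real.sin (x 1 / 2) / 2 : ℝ) * v 1)
    + C₄ * Complex.exp (Complex.I / 2 * (x 2 : ℂ)) * Complex.exp (-(Complex.I / 2) * (x 3 : ℂ)) *
      ((Complex.I / 2 * v 2 + -(Complex.I / 2) * v 3) * (-Real.sin (x 1 / 2) : ℝ)
        + (-(Real.cos (x 1 / 2) / 2) : ℝ) * v 1) := by
  have h1 := fderiv_exp_mul C₃ (-(Complex.I / 2)) (-(Complex.I / 2)) (hasDerivAt_cos_half (x 1)) v
  have h2 := fderiv_exp_mul C₄ (Complex.I / 2) (-(Complex.I / 2)) (hasDerivAt_neg_sin_half (x 1)) v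
  rw [← h1.2, ← h2.2]
  exact congrArg (· v) (fderiv_add h1.1 h2.1)

end ComponentDerivatives

section FrameDerivativesOfComponents

variable {N M : ℝ} {f : ℝ → ℝ} {x : Coord}

lemma cos_eq_exp (t : ℝ) : ((Real.cos t : ℝ) : ℂ) =
    (Complex.exp (Complex.I / 2 * t) ^ 2 + Complex.exp (-(Complex.I / 2) * t) ^ 2) / 2 := by
  rw [Complex.ofReal_cos, Complex.cos, ← Complex.exp_nat_mul, ← Complex.exp_nat_mul]
  congr 3 <;> push_cast <;> ring

lemma sin_eq_exp (t : ℝ) : ((Real.sin t : ℝ) : ℂ) =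
    -Complex.I * (Complex.exp (Complex.I / 2 * t) ^ 2 - Complex.exp (-(Complex.I / 2) * t) ^ 2)
      / 2 := by
  rw [Complex.ofReal_sin, Complex.sin, ← Complex.exp_nat_mul, ← Complex.exp_nat_mul,
    show ((2 : ℕ) : ℂ) * (Complex.I / 2 * t) = t * Complex.I by push_cast; ring,
    show ((2 : ℕ) : ℂ) * (-(Complex.I / 2) * t) = -t * Complex.I by push_cast; ring]
  ring

lemma exp_half_mul_exp_neg_half (t : ℝ) :
    Complex.exp (Complex.I / 2 * t) * Complex.exp (-(Complex.I / 2) * t) = 1 := by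
  rw [← Complex.exp_add]
  simp

/-- Left-invariant fields on S³ act on the spin-1/2 coefficients (P, Q) by constant matrices. The
remaining factors are the normalisations of the frame: `scale` times r + M is 1 / √(r² - N²), and
`scale` times (r + M)² / (2N) is f / (2N). -/
lemma fderiv_compP_frame (h : Profile N M f) (hx : x ∈ chart N) (C₃ C₄ : ℂ) (k : Fin 4) :
    fderiv ℝ (compP C₃ C₄) x (frame N f k x) = (scale N M (x 0) : ℂ) *
      ![0, (x 0 + M) * (Complex.I / 2 * compQ C₃ C₄ x), (x 0 + M) * (-1 / 2 * compQ C₃ C₄ x),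
        (x 0 + M) ^ 2 / (2 * N) * (Complex.I / 2 * compP C₃ C₄ x)] k := by
  have hN : (N : ℂ) ≠ 0 := by exact_mod_cast h.pos.ne'
  have ha : (Real.sqrt (x 0 ^ 2 - N ^ 2) : ℂ) ≠ 0 := by
    exact_mod_cast (Real.sqrt_pos.2 (h.sub_pos hx.1)).ne'
  have hr : (x 0 + M : ℂ) ≠ 0 := by exact_mod_cast (h.add_pos hx.1).ne'
  have hs := (sin_pos_of_mem_chart hx).ne'
  -- Everything is expressed in half angles, in which P and Q are polynomial.
  have e1 : Real.sin (x 1) = 2 * Real.sin (x 1 / 2) * Real.cos (x 1 / 2) := by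
    rw [← Real.sin_two_mul]; ring_nf
  have e2 : Real.cos (x 1) = 2 * Real.cos (x 1 / 2) ^ 2 - 1 := by
    rw [← Real.cos_two_mul]; ring_nf
  rw [e1] at hs
  have hs1 : (Real.sin (x 1 / 2) : ℂ) ≠ 0 := by
    exact_mod_cast fun h0 => hs (by rw [h0]; ring)
  have hs2 : (Real.cos (x 1 / 2) : ℂ) ≠ 0 := by
    exact_mod_cast fun h0 => hs (by rw [h0]; ring)
  have e3 : (Real.sin (x 1 / 2) : ℂ) ^ 2 + (Real.cos (x 1 / 2) : ℂ) ^ 2 = 1 := by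
    exact_mod_cast Real.sin_sq_add_cos_sq (x 1 / 2)
  have e4 := exp_half_mul_exp_neg_half (x 3)
  have hI := Complex.I_sq
  have e5 := cos_eq_exp (x 3)
  have e6 := sin_eq_exp (x 3)
  rw [fderiv_compP]
  simp only [compP, compQ]
  -- With the exponentials and half-angle functions as free variables the claim is polynomial; the
  -- only relations used are E E' = 1, s² + c² = 1 and I² = -1.
  generalize Complex.exp (Complex.I / 2 * x 3) = E at *
  generalize Complex.exp (-(Complex.I / 2) * x 3) = E' at *
  generalize Complex.exp (Complex.I / 2 * x 2) = F at *
  generalize Complex.exp (-(Complex.I / 2) * x 2) = F' at *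
  fin_cases k <;> simp [frame, -Complex.ofReal_sin, -Complex.ofReal_cos]
  all_goals simp only [scale, h.eq _ hx.1, e1, e2, e5, e6]
  all_goals push_cast [-Complex.ofReal_sin, -Complex.ofReal_cos]
  all_goals
    generalize (Real.sin (x 1 / 2) : ℂ) = s at *
    generalize (Real.cos (x 1 / 2) : ℂ) = c at *
    generalize (Real.sqrt (x 0 ^ 2 - N ^ 2) : ℂ) = a at *
    field_simp
  · linear_combination 4 * c * s * E' * (C₃ * c * F' - s * C₄ * F) * e4
      + 2 * E * c * C₄ * F * (E ^ 2 + E' ^ 2) * e3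
  · linear_combination -4 * c * s * E' * (C₃ * c * F' - s * C₄ * F) * e4
      + 2 * E * c * C₄ * F * (E ^ 2 - E' ^ 2) * e3
      + E * (C₃ * F' * s * (E ^ 2 - E' ^ 2) * (-2 * c ^ 2)
        + c * C₄ * F * (E ^ 2 - E' ^ 2) * (2 - 2 * c ^ 2)) * hI

lemma fderiv_compQ_frame (h : Profile N M f) (hx : x ∈ chart N) (C₃ C₄ : ℂ) (k : Fin 4) :
    fderiv ℝ (compQ C₃ C₄) x (frame N f k x) = (scale N M (x 0) : ℂ) *
      ![0, (x 0 + M) * (Complex.I / 2 * compP C₃ C₄ x), (x 0 + M) * (1 / 2 * compP C₃ C₄ x),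
        (x 0 + M) ^ 2 / (2 * N) * (-Complex.I / 2 * compQ C₃ C₄ x)] k := by
  have hN : (N : ℂ) ≠ 0 := by exact_mod_cast h.pos.ne'
  have ha : (Real.sqrt (x 0 ^ 2 - N ^ 2) : ℂ) ≠ 0 := by
    exact_mod_cast (Real.sqrt_pos.2 (h.sub_pos hx.1)).ne'
  have hr : (x 0 + M : ℂ) ≠ 0 := by exact_mod_cast (h.add_pos hx.1).ne'
  have hs := (sin_pos_of_mem_chart hx).ne'
  have e1 : Real.sin (x 1) = 2 * Real.sin (x 1 / 2) * Real.cos (x 1 / 2) := by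
    rw [← Real.sin_two_mul]; ring_nf
  have e2 : Real.cos (x 1) = 2 * Real.cos (x 1 / 2) ^ 2 - 1 := by
    rw [← Real.cos_two_mul]; ring_nf
  rw [e1] at hs
  have hs1 : (Real.sin (x 1 / 2) : ℂ) ≠ 0 := by
    exact_mod_cast fun h0 => hs (by rw [h0]; ring)
  have hs2 : (Real.cos (x 1 / 2) : ℂ) ≠ 0 := by
    exact_mod_cast fun h0 => hs (by rw [h0]; ring)
  have e3 : (Real.sin (x 1 / 2) : ℂ) ^ 2 + (Real.cos (x 1 / 2) : ℂ) ^ 2 = 1 := by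
    exact_mod_cast Real.sin_sq_add_cos_sq (x 1 / 2)
  have e4 := exp_half_mul_exp_neg_half (x 3)
  have hI := Complex.I_sq
  have e5 := cos_eq_exp (x 3)
  have e6 := sin_eq_exp (x 3)
  rw [fderiv_compQ]
  simp only [compP, compQ]
  generalize Complex.exp (Complex.I / 2 * x 3) = E at *
  generalize Complex.exp (-(Complex.I / 2) * x 3) = E' at *
  generalize Complex.exp (Complex.I / 2 * x 2) = F at *
  generalize Complex.exp (-(Complex.I / 2) * x 2) = F' at *
  fin_cases k <;> simp [frame, -Complex.ofReal_sin, -Complex.ofReal_cos]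
  all_goals simp only [scale, h.eq _ hx.1, e1, e2, e5, e6]
  all_goals push_cast [-Complex.ofReal_sin, -Complex.ofReal_cos]
  all_goals
    generalize (Real.sin (x 1 / 2) : ℂ) = s at *
    generalize (Real.cos (x 1 / 2) : ℂ) = c at *
    generalize (Real.sqrt (x 0 ^ 2 - N ^ 2) : ℂ) = a at *
    field_simp
  · linear_combination 4 * c * s * E * (C₃ * s * F' + c * C₄ * F) * e4
      - 2 * E' * c * C₃ * F' * (E ^ 2 + E' ^ 2) * e3
  · linear_combination 4 * c * s * E * (C₃ * s * F' + c * C₄ * F) * e4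
      - 2 * E' * c * C₃ * F' * (E ^ 2 - E' ^ 2) * e3
      + E' * (C₃ * F' * c * (E ^ 2 - E' ^ 2) * (2 * c ^ 2 - 2)
        - s * C₄ * F * (E ^ 2 - E' ^ 2) * (2 * c ^ 2)) * hI
  · ring

end FrameDerivativesOfComponents

/-! ### The spin connection -/

/-- The spin connection matrix `(1/4) ∑ g(∇_{e_k} e_i, e_j) e^i e^j`, up to the factor `scale`. -/
def spinMatrix (N M r : ℂ) : Fin 4 → Matrix (Fin 4) (Fin 4) ℂ :=
  ![0,
    (Complex.I / 2) • !![0, r - N, 0, 0; r - N, 0, 0, 0; 0, 0, 0, -(r + N); 0, 0, -(r + N), 0],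
    (1 / 2 : ℂ) • !![0, -(r - N), 0, 0; r - N, 0, 0, 0; 0, 0, 0, r + N; 0, 0, -(r + N), 0],
    (Complex.I / 2) •
      !![M + (N - (r + M) ^ 2 / (2 * N)), 0, 0, 0; 0, -(M + (N - (r + M) ^ 2 / (2 * N))), 0, 0;
        0, 0, (N - (r + M) ^ 2 / (2 * N)) - M, 0; 0, 0, 0, -((N - (r + M) ^ 2 / (2 * N)) - M)]]

/-- Products of two Clifford generators preserve chirality, hence the block diagonal form. -/
lemma sum_connTable_smul (N M r : ℝ) (k : Fin 4) :
    (1 / 4 : ℂ) • ∑ i, ∑ j, (connTable N M r k i j : ℂ) • (cl i * cl j) = spinMatrix N M r k := by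
  ext a b
  simp only [Fin.sum_univ_four]
  fin_cases k <;> simp [connTable, spinMatrix] <;>
  fin_cases a <;> fin_cases b <;>
    simp [cl, Matrix.mul_apply, Fin.sum_univ_four] <;> ring_nf

lemma spinCov_eq {N M : ℝ} {f : ℝ → ℝ} {x : Coord} (h : Profile N M f) (hx : x ∈ chart N)
    (k : Fin 4) (Ψ : Coord → Spinor) :
    spinCov N f k Ψ x = fderiv ℝ Ψ x (frame N f k x) +
      (scale N M (x 0) : ℂ) • (spinMatrix N M (x 0) k *ᵥ Ψ x) := by
  rw [spinCov, ← sum_connTable_smul]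
  simp only [connCoeff_eq_scale_mul h hx, Matrix.smul_mulVec, Matrix.sum_mulVec,
    Complex.ofReal_mul, mul_smul, ← Finset.smul_sum]
  rw [smul_comm]

lemma fderiv_spinor {Ψ : Coord → Spinor} {x : Coord}
    (h : ∀ a, DifferentiableAt ℝ (fun y => Ψ y a) x) (v : Coord) (a : Fin 4) :
    fderiv ℝ Ψ x v a = fderiv ℝ (fun y => Ψ y a) x v := by
  have : Ψ = fun y a => Ψ y a := rfl
  rw [this, fderiv_pi h]
  rfl

section Parallel

variable {N : ℝ} {x : Coord} (C₃ C₄ : ℂ)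

lemma differentiableAt_uTN (x : Coord) : DifferentiableAt ℝ (uTN C₃ C₄) x := by
  rw [funext (uTN_eq C₃ C₄), differentiableAt_pi]
  intro a
  fin_cases a
  · exact differentiableAt_const _
  · exact differentiableAt_const _
  · exact differentiableAt_compP C₃ C₄ x
  · exact differentiableAt_compQ C₃ C₄ x

lemma differentiableAt_uNeg (x : Coord) : DifferentiableAt ℝ (uNeg C₃ C₄) x := by
  rw [funext (uNeg_eq C₃ C₄), differentiableAt_pi]
  intro a
  fin_cases a
  · exact differentiableAt_compP C₃ C₄ x
  · exact (differentiableAt_compQ C₃ C₄ x).neg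
  · exact differentiableAt_const _
  · exact differentiableAt_const _

lemma fderiv_uTN (x v : Coord) : fderiv ℝ (uTN C₃ C₄) x v =
    ![0, 0, fderiv ℝ (compP C₃ C₄) x v, fderiv ℝ (compQ C₃ C₄) x v] := by
  ext a
  rw [fderiv_spinor (differentiableAt_pi.1 (differentiableAt_uTN C₃ C₄ x))]
  simp only [uTN_eq]
  fin_cases a <;> simp

lemma fderiv_uNeg (x v : Coord) : fderiv ℝ (uNeg C₃ C₄) x v =
    ![fderiv ℝ (compP C₃ C₄) x v, -fderiv ℝ (compQ C₃ C₄) x v, 0, 0] := by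
  ext a
  rw [fderiv_spinor (differentiableAt_pi.1 (differentiableAt_uNeg C₃ C₄ x))]
  simp only [uNeg_eq]
  fin_cases a <;> simp

/-- For M = N the lower blocks of the connection matrices are the negatives of the matrices by which
the frame acts on (P, Q): for e₄, the two N's in (N - (r + N)² / (2N)) - N cancel. -/
lemma spinCov_uTN (hN : 0 < N) (hx : x ∈ chart N) (k : Fin 4) :
    spinCov N (fTN N) k (uTN C₃ C₄) x = 0 := by
  have h := profile_fTN hN
  have hN' : (N : ℂ) ≠ 0 := by exact_mod_cast hN.ne'
  rw [spinCov_eq h hx, fderiv_uTN, fderiv_compP_frame h hx, fderiv_compQ_frame h hx, uTN_eq]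
  ext a
  fin_cases k <;> fin_cases a <;>
    simp [spinMatrix] <;> field_simp <;> ring

/-- For M = -N the same cancellation happens in the upper blocks, where r - N = r + M; the sign of Q
matches the basis used there. -/
lemma spinCov_uNeg (hN : 0 < N) (hx : x ∈ chart N) (k : Fin 4) :
    spinCov N (fNeg N) k (uNeg C₃ C₄) x = 0 := by
  have h := profile_fNeg hN
  have hN' : (N : ℂ) ≠ 0 := by exact_mod_cast hN.ne'
  rw [spinCov_eq h hx, fderiv_uNeg, fderiv_compP_frame h hx, fderiv_compQ_frame h hx, uNeg_eq]
  ext a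
  fin_cases k <;> fin_cases a <;>
    simp [spinMatrix] <;> field_simp <;> ring

end Parallel

/-! ### Smoothness -/

section Smooth

lemma norm_toCartesian {x : Coord} (hx : 0 ≤ x 0) : ‖toCartesian x‖ = x 0 := by
  have h1 := Real.sin_sq_add_cos_sq (x 1 / 2)
  have h2 := Real.sin_sq_add_cos_sq ((x 3 + x 2) / 2)
  have h3 := Real.sin_sq_add_cos_sq ((x 3 - x 2) / 2)
  rw [EuclideanSpace.norm_eq, Fin.sum_univ_four, Real.sqrt_eq_iff_mul_self_eq (by positivity) hx]
  simp only [Real.norm_eq_abs, sq_abs, toCartesian]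
  simp
  linear_combination x 0 ^ 2 * Real.cos (x 1 / 2) ^ 2 * h2
    + x 0 ^ 2 * Real.sin (x 1 / 2) ^ 2 * h3 + x 0 ^ 2 * h1

variable {N : ℝ} {V W : Type*} [NormedAddCommGroup V] [NormedSpace ℝ V]

lemma IsSmoothSection.pi {ι : Type*} [Fintype ι] {F : Coord → ι → V}
    (h : ∀ i, IsSmoothSection N fun x => F x i) : IsSmoothSection N F := by
  choose G hG using h
  exact ⟨fun y i => G i y, contDiffOn_pi.2 fun i => (hG i).1,
    fun x hx => funext fun i => (hG i).2 x hx⟩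

lemma IsSmoothSection.const (c : V) : IsSmoothSection N fun _ => c :=
  ⟨fun _ => c, contDiffOn_const, fun _ _ => rfl⟩

lemma IsSmoothSection.add {F F' : Coord → V} (h : IsSmoothSection N F)
    (h' : IsSmoothSection N F') : IsSmoothSection N fun x => F x + F' x := by
  obtain ⟨G, hG, e⟩ := h
  obtain ⟨G', hG', e'⟩ := h'
  exact ⟨fun y => G y + G' y, hG.add hG', fun x hx => congrArg₂ _ (e x hx) (e' x hx)⟩

lemma IsSmoothSection.mul {F F' : Coord → ℂ} (h : IsSmoothSection N F)
    (h' : IsSmoothSection N F') : IsSmoothSection N fun x => F x * F' x := by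
  obtain ⟨G, hG, e⟩ := h
  obtain ⟨G', hG', e'⟩ := h'
  exact ⟨fun y => G y * G' y, hG.mul hG', fun x hx => congrArg₂ _ (e x hx) (e' x hx)⟩

lemma IsSmoothSection.sum {ι : Type*} {s : Finset ι} {F : ι → Coord → V}
    (h : ∀ i, IsSmoothSection N (F i)) : IsSmoothSection N fun x => ∑ i ∈ s, F i x := by
  choose G hG using h
  exact ⟨fun y => ∑ i ∈ s, G i y, ContDiffOn.sum fun i _ => (hG i).1,
    fun x hx => Finset.sum_congr rfl fun i _ => (hG i).2 x hx⟩

lemma IsSmoothSection.mulVec {F : Coord → Spinor} (A : Matrix (Fin 4) (Fin 4) ℂ)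
    (h : IsSmoothSection N F) : IsSmoothSection N fun x => A *ᵥ F x := by
  obtain ⟨G, hG, e⟩ := h
  refine .pi fun a => .sum (s := Finset.univ) (F := fun b x => A a b * F x b) fun b =>
    .mul (.const _) ⟨fun y => G y b, contDiffOn_pi.1 hG b, fun x hx => ?_⟩
  exact congrFun (e x hx) b

/-- Radial functions which are smooth for `r > N` are smooth on the space. -/
lemma IsSmoothSection.radial (hN : 0 < N) {φ : ℝ → ℝ} (h : ContDiffOn ℝ ∞ φ (Set.Ioi N)) :
    IsSmoothSection N fun x => (φ (x 0) : ℂ) := by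
  refine ⟨fun y => (φ ‖y‖ : ℂ), ?_, fun x hx => ?_⟩
  · refine Complex.ofRealCLM.contDiff.comp_contDiffOn (h.comp (fun y hy => ?_) fun y hy => hy)
    have : y ≠ 0 := norm_pos_iff.1 (hN.trans hy)
    exact (contDiffAt_norm ℝ this).contDiffWithinAt
  · simp only [norm_toCartesian (hN.trans hx.1).le]

lemma IsSmoothSection.coord (i : Fin 4) :
    IsSmoothSection N fun x => ((toCartesian x i : ℝ) : ℂ) :=
  ⟨fun y => ((y i : ℝ) : ℂ), (Complex.ofRealCLM.contDiff.comp
    (EuclideanSpace.proj (𝕜 := ℝ) i).contDiff).contDiffOn, fun _ _ => rfl⟩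

lemma IsSmoothSection.congr {F F' : Coord → V} (h : IsSmoothSection N F)
    (e : ∀ x ∈ chart N, F' x = F x) : IsSmoothSection N F' := by
  obtain ⟨G, hG, e'⟩ := h
  exact ⟨G, hG, fun x hx => (e x hx).trans (e' x hx)⟩

lemma isSmoothSection_inv_radius (hN : 0 < N) :
    IsSmoothSection N fun x => (((x 0)⁻¹ : ℝ) : ℂ) :=
  .radial hN (φ := fun r => r⁻¹) (contDiffOn_id.inv fun _ hr => (hN.trans hr).ne')

lemma exp_half_mul_exp_half (s t : ℝ) :
    Complex.exp (Complex.I / 2 * s) * Complex.exp (Complex.I / 2 * t) =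
      Real.cos ((t + s) / 2) + Complex.I * Real.sin ((t + s) / 2) := by
  rw [← Complex.exp_add, Complex.ofReal_cos, Complex.ofReal_sin, mul_comm Complex.I,
    ← Complex.exp_mul_I]
  congr 1
  push_cast
  ring

lemma exp_neg_half_mul_exp_half (s t : ℝ) :
    Complex.exp (-(Complex.I / 2) * s) * Complex.exp (Complex.I / 2 * t) =
      Real.cos ((t - s) / 2) + Complex.I * Real.sin ((t - s) / 2) := by
  have := exp_half_mul_exp_half (-s) t
  rw [← sub_eq_add_neg] at this
  rw [← this]
  push_cast
  ring_nf

lemma exp_half_mul_exp_neg_half' (s t : ℝ) :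
    Complex.exp (Complex.I / 2 * s) * Complex.exp (-(Complex.I / 2) * t) =
      Real.cos ((t - s) / 2) - Complex.I * Real.sin ((t - s) / 2) := by
  rw [mul_comm, exp_neg_half_mul_exp_half, show (s - t) / 2 = -((t - s) / 2) by ring,
    Real.cos_neg, Real.sin_neg]
  push_cast
  ring

lemma exp_neg_half_mul_exp_neg_half (s t : ℝ) :
    Complex.exp (-(Complex.I / 2) * s) * Complex.exp (-(Complex.I / 2) * t) =
      Real.cos ((t + s) / 2) - Complex.I * Real.sin ((t + s) / 2) := by
  have := exp_half_mul_exp_neg_half' (-s) t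
  rw [sub_neg_eq_add] at this
  rw [← this]
  push_cast
  ring_nf

/-- In Cartesian coordinates r P = C₃ (y₂ + i y₃) + C₄ (y₀ + i y₁), which is linear. For Q the
conjugate expressions occur. -/
lemma isSmoothSection_compP (hN : 0 < N) (C₃ C₄ : ℂ) : IsSmoothSection N (compP C₃ C₄) := by
  refine ((((IsSmoothSection.coord 2).add ((IsSmoothSection.const Complex.I).mul (.coord 3))).mul
    (.const C₃)).add (((IsSmoothSection.coord 0).add
      ((IsSmoothSection.const Complex.I).mul (.coord 1))).mul (.const C₄))).mul
    (isSmoothSection_inv_radius hN) |>.congr fun x hx => ?_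
  have hr : (x 0 : ℂ) ≠ 0 := by exact_mod_cast (hN.trans hx.1).ne'
  have h1 := exp_half_mul_exp_half (x 2) (x 3)
  have h2 := exp_neg_half_mul_exp_half (x 2) (x 3)
  simp [toCartesian, -Complex.ofReal_cos, -Complex.ofReal_sin]
  field_simp
  simp only [compP]
  linear_combination C₄ * (Real.cos (x 1 / 2) : ℂ) * h1 + C₃ * (Real.sin (x 1 / 2) : ℂ) * h2

lemma isSmoothSection_compQ (hN : 0 < N) (C₃ C₄ : ℂ) : IsSmoothSection N (compQ C₃ C₄) := by
  refine ((((IsSmoothSection.coord 0).add ((IsSmoothSection.const (-Complex.I)).mul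
    (.coord 1))).mul (.const C₃)).add (((IsSmoothSection.coord 2).add
      ((IsSmoothSection.const (-Complex.I)).mul (.coord 3))).mul (.const (-C₄)))).mul
    (isSmoothSection_inv_radius hN) |>.congr fun x hx => ?_
  have hr : (x 0 : ℂ) ≠ 0 := by exact_mod_cast (hN.trans hx.1).ne'
  have h1 := exp_half_mul_exp_neg_half' (x 2) (x 3)
  have h2 := exp_neg_half_mul_exp_neg_half (x 2) (x 3)
  simp [toCartesian, -Complex.ofReal_cos, -Complex.ofReal_sin]
  field_simp
  simp only [compQ, Complex.ofReal_neg]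
  linear_combination -C₄ * (Real.sin (x 1 / 2) : ℂ) * h1 + C₃ * (Real.cos (x 1 / 2) : ℂ) * h2

lemma isParallelSpinor_uTN (hN : 0 < N) (C₃ C₄ : ℂ) :
    IsParallelSpinor N (fTN N) (uTN C₃ C₄) := by
  refine ⟨.pi fun a => ?_, fun x hx k => spinCov_uTN C₃ C₄ hN hx k⟩
  simp only [uTN_eq]
  fin_cases a
  · exact .const 0
  · exact .const 0
  · exact isSmoothSection_compP hN C₃ C₄
  · exact isSmoothSection_compQ hN C₃ C₄

lemma isParallelSpinor_uNeg (hN : 0 < N) (C₃ C₄ : ℂ) :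
    IsParallelSpinor N (fNeg N) (uNeg C₃ C₄) := by
  refine ⟨.pi fun a => ?_, fun x hx k => spinCov_uNeg C₃ C₄ hN hx k⟩
  simp only [uNeg_eq]
  fin_cases a
  · exact isSmoothSection_compP hN C₃ C₄
  · exact ((IsSmoothSection.const (-1)).mul (isSmoothSection_compQ hN C₃ C₄)).congr
      fun x _ => (neg_one_mul _).symm
  · exact .const 0
  · exact .const 0

end Smooth

/-! ### Fields built from a parallel spinor and a radial function -/

/-- The field `φ(r) ∑ A_i u ⊗ e^i`. -/
def radialField (φ : ℝ → ℝ) (A : Fin 4 → Matrix (Fin 4) (Fin 4) ℂ) (u : Coord → Spinor)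
    (x : Coord) : VectorSpinor :=
  fun i => (φ (x 0) : ℂ) • (A i *ᵥ u x)

/-- For parallel `u`, the matrix by which `∇_{e_j} (φ(r) A_i u ⊗ e^i) (e_k)` is obtained from `u`, up
to the factor `scale * φ`, where `l = (r² - N²) φ' / φ`. -/
def covMatrix (N M r l : ℝ) (A : Fin 4 → Matrix (Fin 4) (Fin 4) ℂ) (j k : Fin 4) :
    Matrix (Fin 4) (Fin 4) ℂ :=
  (![(l : ℂ), 0, 0, 0] j) • A k + (spinMatrix N M r j * A k - A k * spinMatrix N M r j)
    - ∑ i, (connTable N M r j k i : ℂ) • A i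

section RadialField

variable {N M : ℝ} {f : ℝ → ℝ} {x : Coord}

lemma fderiv_smul_mulVec {φ : ℝ → ℝ} {φ' : ℝ} {u : Coord → Spinor}
    (hφ : HasDerivAt φ φ' (x 0)) (hu : DifferentiableAt ℝ u x)
    (A : Matrix (Fin 4) (Fin 4) ℂ) (v : Coord) :
    fderiv ℝ (fun y => (φ (y 0) : ℂ) • (A *ᵥ u y)) x v =
      (φ (x 0) : ℂ) • (A *ᵥ fderiv ℝ u x v) + ((φ' * v 0 : ℝ) : ℂ) • (A *ᵥ u x) := by
  let L : Spinor →L[ℝ] Spinor :=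
    (LinearMap.toContinuousLinearMap (Matrix.mulVecLin A)).restrictScalars ℝ
  have h1 : HasFDerivAt (fun y => A *ᵥ u y) (L.comp (fderiv ℝ u x)) x :=
    L.hasFDerivAt.comp x hu.hasFDerivAt
  have h2 := (hasFDerivAt_comp_coord 0 hφ.ofReal_comp).smul h1
  refine (congrArg (· v) h2.fderiv).trans ?_
  simp [L, mul_comm]

lemma frame_apply_zero (N : ℝ) (f : ℝ → ℝ) (x : Coord) (j : Fin 4) :
    frame N f j x 0 = ![1 / f (x 0), 0, 0, 0] j := by
  fin_cases j <;> simp [frame]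

/-- Parallelism replaces e_j(u) by minus the connection matrix applied to u, so the constant matrix
A_k contributes only its commutator with that matrix. -/
lemma vectorSpinorCov_radialField (h : Profile N M f) (hx : x ∈ chart N) {φ : ℝ → ℝ}
    {φ' l : ℝ} {u : Coord → Spinor} (hφ : HasDerivAt φ φ' (x 0))
    (hl : φ' * (x 0 ^ 2 - N ^ 2) = φ (x 0) * l) (hu : DifferentiableAt ℝ u x)
    (hp : ∀ k, spinCov N f k u x = 0) (A : Fin 4 → Matrix (Fin 4) (Fin 4) ℂ) (j k : Fin 4) :
    vectorSpinorCov N f j k (radialField φ A u) x =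
      ((scale N M (x 0) * φ (x 0) : ℝ) : ℂ) • (covMatrix N M (x 0) l A j k *ᵥ u x) := by
  have e1 : fderiv ℝ u x (frame N f j x) =
      -((scale N M (x 0) : ℂ) • (spinMatrix N M (x 0) j *ᵥ u x)) := by
    rw [← add_eq_zero_iff_eq_neg, ← spinCov_eq h hx, hp]
  -- Only e₁ = f⁻¹ ∂_r has a radial component, and 1 / f equals `scale` times r² - N²; this is why l
  -- carries that factor.
  have e2 : φ' * frame N f j x 0 = scale N M (x 0) * φ (x 0) * ![l, 0, 0, 0] j := by
    rw [frame_apply_zero]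
    fin_cases j <;> simp
    have h0 := h.sub_pos hx.1
    have h1 := Real.sqrt_pos.2 h0
    have h2 := h.add_pos hx.1
    have h3 := Real.sq_sqrt h0.le
    rw [h.eq _ hx.1, scale]
    field_simp
    rw [h3]
    linear_combination hl
  have e3 : ((![l, 0, 0, 0] j : ℝ) : ℂ) = ![(l : ℂ), 0, 0, 0] j := by
    fin_cases j <;> simp
  rw [vectorSpinorCov, spinCov_eq h hx]
  simp only [radialField, fderiv_smul_mulVec hφ hu, e1, e2, Complex.ofReal_mul, e3,
    connCoeff_eq_scale_mul h hx, covMatrix, Matrix.sub_mulVec, Matrix.add_mulVec,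
    Matrix.smul_mulVec, Matrix.sum_mulVec, Matrix.mulVec_neg, Matrix.mulVec_smul,
    ← Matrix.mulVec_mulVec, smul_sub, smul_add, Finset.smul_sum, smul_smul, smul_neg]
  have e4 : ∀ i, (scale N M (x 0) : ℂ) * (connTable N M (x 0) j k i : ℂ) * (φ (x 0) : ℂ) =
      (scale N M (x 0) : ℂ) * (φ (x 0) : ℂ) * (connTable N M (x 0) j k i : ℂ) := fun i => by ring
  simp only [e4, mul_comm (φ (x 0) : ℂ) (scale N M (x 0) : ℂ)]
  abel

lemma isRaritaSchwingerField_radialField (h : Profile N M f) {φ φ' l : ℝ → ℝ}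
    {u : Coord → Spinor} (hφ : ContDiffOn ℝ ∞ φ (Set.Ioi N))
    (hφ' : ∀ r, N < r → HasDerivAt φ (φ' r) r)
    (hl : ∀ r, N < r → φ' r * (r ^ 2 - N ^ 2) = φ r * l r)
    (hu : Differentiable ℝ u) (hp : IsParallelSpinor N f u)
    {A : Fin 4 → Matrix (Fin 4) (Fin 4) ℂ}
    (hA : ∀ x, ∑ i, cl i *ᵥ (A i *ᵥ u x) = 0)
    (hD : ∀ x k, ∑ j, cl j *ᵥ (covMatrix N M (x 0) (l (x 0)) A j k *ᵥ u x) = 0)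
    (hdiv : ∀ x, ∑ i, covMatrix N M (x 0) (l (x 0)) A i i *ᵥ u x = 0) :
    IsRaritaSchwingerField N f (radialField φ A u) := by
  have key : ∀ x ∈ chart N, ∀ j k, vectorSpinorCov N f j k (radialField φ A u) x =
      ((scale N M (x 0) * φ (x 0) : ℝ) : ℂ) •
        (covMatrix N M (x 0) (l (x 0)) A j k *ᵥ u x) := fun x hx j k =>
    vectorSpinorCov_radialField h hx (hφ' _ hx.1) (hl _ hx.1) (hu x) (hp.2 x hx) A j k
  constructor
  · refine .pi fun i => .pi fun a => ?_
    obtain ⟨G, hG, e⟩ := hp.1.mulVec (A i)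
    refine (IsSmoothSection.radial h.pos hφ).mul
      ⟨fun y => G y a, contDiffOn_pi.1 hG a, fun x hx => congrFun (e x hx) a⟩
  · intro x _
    simp only [spin32, Set.mem_ofPred_eq, radialField, Matrix.mulVec_smul, ← Finset.smul_sum, hA,
      smul_zero]
  · intro x hx
    -- The full twisted Dirac operator annihilates the field, so the projection has nothing to
    -- remove.
    have : twistedDirac N f (radialField φ A u) x = 0 := by
      funext k
      simp only [twistedDirac, key x hx, Matrix.mulVec_smul, ← Finset.smul_sum, hD, smul_zero,
        Pi.zero_apply]
    simp only [raritaSchwingerOp, this]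
    funext i
    simp [proj32]
  · intro x hx
    simp only [divergence, key x hx, ← Finset.smul_sum, hdiv, smul_zero]

end RadialField

/-! ### The two explicit fields -/

/-- The matrices `(e^1 e^4 + e^2 e^3) e^i`. -/
def matTN : Fin 4 → Matrix (Fin 4) (Fin 4) ℂ :=
  ![!![0, 0, 2 * Complex.I, 0; 0, 0, 0, -2 * Complex.I; 0, 0, 0, 0; 0, 0, 0, 0],
    !![0, 0, 0, -2; 0, 0, 2, 0; 0, 0, 0, 0; 0, 0, 0, 0],
    !![0, 0, 0, -2 * Complex.I; 0, 0, -2 * Complex.I, 0; 0, 0, 0, 0; 0, 0, 0, 0],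
    !![0, 0, -2, 0; 0, 0, 0, -2; 0, 0, 0, 0; 0, 0, 0, 0]]

/-- The matrices `-2 (e^1 e^4 + e^2 e^3)`, `e^2 e^4 - e^1 e^3`, `e^1 e^2 + e^3 e^4` and `0`. -/
def matNeg : Fin 4 → Matrix (Fin 4) (Fin 4) ℂ :=
  ![!![-4 * Complex.I, 0, 0, 0; 0, 4 * Complex.I, 0, 0; 0, 0, 0, 0; 0, 0, 0, 0],
    !![0, 2, 0, 0; -2, 0, 0, 0; 0, 0, 0, 0; 0, 0, 0, 0],
    !![0, 2 * Complex.I, 0, 0; 2 * Complex.I, 0, 0, 0; 0, 0, 0, 0; 0, 0, 0, 0],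
    0]

lemma sigmaTN_eq (N : ℝ) (u : Coord → Spinor) :
    sigmaTN N u = radialField (fun r => 1 / (r + N) ^ 2) matTN u := by
  have : ∀ i, (cl 0 * cl 3 + cl 1 * cl 2) * cl i = matTN i := by
    intro i
    ext a b
    fin_cases i <;> fin_cases a <;> fin_cases b <;>
      simp [cl, matTN, Matrix.mul_apply, Fin.sum_univ_four] <;> ring_nf <;> simp
  funext x i
  rw [sigmaTN, radialField, ← this, Matrix.mulVec_mulVec]

lemma sigmaNeg_eq (N : ℝ) (u : Coord → Spinor) :
    sigmaNeg N u = radialField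
      (fun r => 1 / ((r - N) ^ (1 / 2 : ℝ) * (r + N) ^ (5 / 2 : ℝ))) matNeg u := by
  have h0 : (-2 : ℂ) • (cl 0 * cl 3 + cl 1 * cl 2) = matNeg 0 := by
    ext a b
    fin_cases a <;> fin_cases b <;>
      simp [cl, matNeg] <;> ring_nf
  have h1 : cl 1 * cl 3 - cl 0 * cl 2 = matNeg 1 := by
    ext a b
    fin_cases a <;> fin_cases b <;>
      simp [cl, matNeg] <;> ring_nf
  have h2 : cl 0 * cl 1 + cl 2 * cl 3 = matNeg 2 := by
    ext a b
    fin_cases a <;> fin_cases b <;>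
      simp [cl, matNeg] <;> ring_nf
  funext x i
  rw [sigmaNeg, radialField, ← Matrix.smul_mulVec, h0, h1, h2]
  fin_cases i <;> simp
  simp [matNeg]

lemma covMatrix_mulVec (N M r l : ℝ) (A : Fin 4 → Matrix (Fin 4) (Fin 4) ℂ) (j k : Fin 4)
    (u : Spinor) : covMatrix N M r l A j k *ᵥ u =
      (![(l : ℂ), 0, 0, 0] j) • (A k *ᵥ u) + spinMatrix N M r j *ᵥ (A k *ᵥ u)
        - A k *ᵥ (spinMatrix N M r j *ᵥ u) - ∑ i, (connTable N M r j k i : ℂ) • (A i *ᵥ u) := by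
  simp only [covMatrix, Matrix.sub_mulVec, Matrix.add_mulVec, Matrix.smul_mulVec,
    Matrix.sum_mulVec, ← Matrix.mulVec_mulVec, add_sub_assoc]

/-- The action of the Clifford matrices on components. -/
lemma cl_mulVec (i : Fin 4) (a b c d : ℂ) : cl i *ᵥ ![a, b, c, d] =
    ![![c, d, -a, -b], ![Complex.I * d, Complex.I * c, Complex.I * b, Complex.I * a],
      ![-d, c, -b, a], ![Complex.I * c, -(Complex.I * d), Complex.I * a, -(Complex.I * b)]] i := by
  ext a
  fin_cases i <;> fin_cases a <;> simp [cl] <;> ring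

lemma spinMatrix_mulVec (N M r : ℂ) (i : Fin 4) (a b c d : ℂ) :
    spinMatrix N M r i *ᵥ ![a, b, c, d] =
    ![0, ![Complex.I / 2 * (r - N) * b, Complex.I / 2 * (r - N) * a,
        -(Complex.I / 2 * (r + N) * d), -(Complex.I / 2 * (r + N) * c)],
      ![-(1 / 2 * (r - N) * b), 1 / 2 * (r - N) * a, 1 / 2 * (r + N) * d, -(1 / 2 * (r + N) * c)],
      ![Complex.I / 2 * (M + (N - (r + M) ^ 2 / (2 * N))) * a,
        -(Complex.I / 2 * (M + (N - (r + M) ^ 2 / (2 * N))) * b),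
        Complex.I / 2 * ((N - (r + M) ^ 2 / (2 * N)) - M) * c,
        -(Complex.I / 2 * ((N - (r + M) ^ 2 / (2 * N)) - M) * d)]] i := by
  ext a
  fin_cases i <;> fin_cases a <;> simp [spinMatrix] <;> ring

lemma matTN_mulVec (i : Fin 4) (a b p q : ℂ) : matTN i *ᵥ ![a, b, p, q] =
    ![![2 * Complex.I * p, -(2 * Complex.I * q), 0, 0], ![-(2 * q), 2 * p, 0, 0],
      ![-(2 * Complex.I * q), -(2 * Complex.I * p), 0, 0], ![-(2 * p), -(2 * q), 0, 0]] i := by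
  ext a
  fin_cases i <;> fin_cases a <;> simp [matTN] <;> ring

lemma matNeg_mulVec (i : Fin 4) (p q c d : ℂ) : matNeg i *ᵥ ![p, q, c, d] =
    ![![-(4 * Complex.I * p), 4 * Complex.I * q, 0, 0], ![2 * q, -(2 * p), 0, 0],
      ![2 * Complex.I * q, 2 * Complex.I * p, 0, 0], 0] i := by
  ext a
  fin_cases i <;> fin_cases a <;> simp [matNeg] <;> ring

lemma sum_covMatrix_matTN_self {N : ℝ} (hN : (N : ℂ) ≠ 0) (r : ℝ) (p q : ℂ) :
    ∑ i, covMatrix N N r (-2 * (r - N)) matTN i i *ᵥ ![0, 0, p, q] = 0 := by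
  simp only [covMatrix_mulVec, matTN_mulVec, spinMatrix_mulVec, Fin.sum_univ_four, connTable]
  ext a
  fin_cases a <;> simp [matTN_mulVec, spinMatrix_mulVec, -Matrix.mulVec_cons] <;> field_simp <;> ring

lemma sum_covMatrix_matNeg_self (N r : ℝ) (p q : ℂ) :
    ∑ i, covMatrix N (-N) r (-3 * r + 2 * N) matNeg i i *ᵥ ![p, -q, 0, 0] = 0 := by
  simp only [covMatrix_mulVec, matNeg_mulVec, spinMatrix_mulVec, Fin.sum_univ_four, connTable]
  ext a
  fin_cases a <;> simp [matNeg_mulVec, spinMatrix_mulVec, -Matrix.mulVec_cons] <;> ring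

/-- The identity is checked on spinors of one chirality, with p and q arbitrary: beyond being
parallel, u need not satisfy any relation between its components. -/
lemma sum_cl_mulVec_covMatrix_matTN {N : ℝ} (hN : (N : ℂ) ≠ 0) (r : ℝ) (p q : ℂ) (k : Fin 4) :
    ∑ j, cl j *ᵥ (covMatrix N N r (-2 * (r - N)) matTN j k *ᵥ ![0, 0, p, q]) = 0 := by
  simp only [covMatrix_mulVec, matTN_mulVec, spinMatrix_mulVec, Fin.sum_univ_four, connTable,
    Matrix.mulVec_add, Matrix.mulVec_sub, Matrix.mulVec_smul]
  ext a
  fin_cases k <;> fin_cases a <;>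
    simp [matTN_mulVec, spinMatrix_mulVec, cl_mulVec, -Matrix.mulVec_cons] <;> field_simp <;>
    first | ring1 | (ring_nf; simp only [Complex.I_sq, Complex.I_pow_three]; ring1)

lemma sum_cl_mulVec_covMatrix_matNeg {N : ℝ} (hN : (N : ℂ) ≠ 0) (r : ℝ) (p q : ℂ) (k : Fin 4) :
    ∑ j, cl j *ᵥ (covMatrix N (-N) r (-3 * r + 2 * N) matNeg j k *ᵥ ![p, -q, 0, 0]) = 0 := by
  simp only [covMatrix_mulVec, matNeg_mulVec, spinMatrix_mulVec, Fin.sum_univ_four, connTable,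
    Matrix.mulVec_add, Matrix.mulVec_sub, Matrix.mulVec_smul]
  ext a
  fin_cases k <;> fin_cases a <;>
    simp [matNeg_mulVec, spinMatrix_mulVec, cl_mulVec, -Matrix.mulVec_cons] <;> field_simp <;>
    first | ring1 | (ring_nf; simp only [Complex.I_sq, Complex.I_pow_three]; ring1)

section

variable {N : ℝ} (C₃ C₄ : ℂ)

lemma isRaritaSchwingerField_sigmaTN (hN : 0 < N) :
    IsRaritaSchwingerField N (fTN N) (sigmaTN N (uTN C₃ C₄)) := by
  rw [sigmaTN_eq]
  refine isRaritaSchwingerField_radialField (profile_fTN hN) (φ' := fun r => -2 / (r + N) ^ 3)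
    -- Here φ' / φ = -2 / (r + N), multiplied by r² - N².
    (l := fun r => -2 * (r - N)) ?_ ?_ ?_ (fun x => differentiableAt_uTN C₃ C₄ x)
    (isParallelSpinor_uTN hN C₃ C₄) ?_ ?_ ?_
  · refine contDiffOn_const.div (by fun_prop) fun r hr => ?_
    have : 0 < r + N := by linarith [Set.mem_Ioi.1 hr]
    positivity
  · intro r hr
    have : 0 < r + N := by linarith
    have := (((hasDerivAt_id r).add_const N).pow 2).inv (by simp; positivity)
    simp only [one_div]
    refine this.congr_deriv ?_
    simp
    field_simp
  · intro r hr
    have : 0 < r + N := by linarith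
    field_simp
    ring
  · intro x
    rw [uTN_eq]
    simp only [matTN_mulVec, Fin.sum_univ_four]
    ext a
    fin_cases a <;> simp [cl_mulVec, -Matrix.mulVec_cons]
  · intro x k
    rw [uTN_eq]
    simpa using sum_cl_mulVec_covMatrix_matTN (by exact_mod_cast hN.ne') (x 0) _ _ k
  · intro x
    rw [uTN_eq]
    simpa using sum_covMatrix_matTN_self (by exact_mod_cast hN.ne') (x 0) _ _

lemma isRaritaSchwingerField_sigmaNeg (hN : 0 < N) :
    IsRaritaSchwingerField N (fNeg N) (sigmaNeg N (uNeg C₃ C₄)) := by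
  rw [sigmaNeg_eq]
  refine isRaritaSchwingerField_radialField (profile_fNeg hN)
    (φ' := fun r => -(1 / ((r - N) ^ (1 / 2 : ℝ) * (r + N) ^ (5 / 2 : ℝ))) *
      (1 / 2 / (r - N) + 5 / 2 / (r + N)))
    -- The logarithmic derivative of φ times r² - N² is -(r + N)/2 - 5(r - N)/2.
    (l := fun r => -3 * r + 2 * N) ?_ ?_ ?_ (fun x => differentiableAt_uNeg C₃ C₄ x)
    (isParallelSpinor_uNeg hN C₃ C₄) ?_ ?_ ?_
  · have h1 : ∀ r ∈ Set.Ioi N, r - N ≠ 0 := fun r hr => (sub_pos.2 hr).ne'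
    have h2 : ∀ r ∈ Set.Ioi N, r + N ≠ 0 := fun r hr => ne_of_gt <| by
      have := Set.mem_Ioi.1 hr
      linarith
    refine contDiffOn_const.div (((contDiffOn_id.sub contDiffOn_const).rpow_const_of_ne h1).mul
      ((contDiffOn_id.add contDiffOn_const).rpow_const_of_ne h2)) fun r hr => ?_
    have h3 : 0 < r - N := sub_pos.2 hr
    have h4 : 0 < r + N := by linarith
    positivity
  · intro r hr
    have h1 : 0 < r - N := sub_pos.2 hr
    have h2 : 0 < r + N := by linarith
    have := ((((hasDerivAt_id r).sub_const N).rpow_const (p := 1 / 2) (.inl h1.ne')).mul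
      (((hasDerivAt_id r).add_const N).rpow_const (p := 5 / 2) (.inl h2.ne'))).inv
      (mul_pos (Real.rpow_pos_of_pos h1 _) (Real.rpow_pos_of_pos h2 _)).ne'
    simp only [one_div (_ * _ : ℝ)]
    refine this.congr_deriv ?_
    simp only [id, Pi.mul_apply, Real.rpow_sub_one h1.ne', Real.rpow_sub_one h2.ne']
    have h3 := Real.rpow_pos_of_pos h1 (1 / 2)
    have h4 := Real.rpow_pos_of_pos h2 (5 / 2)
    field_simp
  · intro r hr
    have h1 : 0 < r - N := sub_pos.2 hr
    have h2 : 0 < r + N := by linarith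
    have h3 := Real.rpow_pos_of_pos h1 (1 / 2)
    have h4 := Real.rpow_pos_of_pos h2 (5 / 2)
    field_simp
    ring
  · intro x
    rw [uNeg_eq]
    simp only [matNeg_mulVec, Fin.sum_univ_four]
    ext a
    fin_cases a <;> simp [cl_mulVec, -Matrix.mulVec_cons] <;> ring_nf
  · intro x k
    rw [uNeg_eq]
    simpa using sum_cl_mulVec_covMatrix_matNeg (by exact_mod_cast hN.ne') (x 0) _ _ k
  · intro x
    rw [uNeg_eq]
    simpa using sum_covMatrix_matNeg_self N (x 0) _ _

end

/-! ### Norms -/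

lemma norm_exp_half (t : ℝ) : ‖Complex.exp (Complex.I / 2 * t)‖ = 1 := by
  rw [show Complex.I / 2 * t = ((t / 2 : ℝ) : ℂ) * Complex.I by push_cast; ring]
  exact Complex.norm_exp_ofReal_mul_I _

lemma norm_exp_neg_half (t : ℝ) : ‖Complex.exp (-(Complex.I / 2) * t)‖ = 1 := by
  rw [show -(Complex.I / 2) * t = ((-t / 2 : ℝ) : ℂ) * Complex.I by push_cast; ring]
  exact Complex.norm_exp_ofReal_mul_I _

lemma norm_compP_sq_add_norm_compQ_sq (C₃ C₄ : ℂ) (x : Coord) :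
    ‖compP C₃ C₄ x‖ ^ 2 + ‖compQ C₃ C₄ x‖ ^ 2 = ‖C₃‖ ^ 2 + ‖C₄‖ ^ 2 := by
  -- Up to phases, (P, Q) is the image of (C₃, C₄) under a real orthogonal matrix in θ/2.
  have key : ∀ (s c : ℝ) (A B : ℂ), s ^ 2 + c ^ 2 = 1 →
      ‖A * s + B * c‖ ^ 2 + ‖A * c + B * ((-s : ℝ) : ℂ)‖ ^ 2 = ‖A‖ ^ 2 + ‖B‖ ^ 2 := by
    intro s c A B h
    simp only [← Complex.normSq_eq_norm_sq, Complex.normSq_apply]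
    simp
    linear_combination (A.re ^ 2 + A.im ^ 2 + B.re ^ 2 + B.im ^ 2) * h
  have e1 : ‖compP C₃ C₄ x‖ = ‖C₃ * Complex.exp (-(Complex.I / 2) * x 2) * Real.sin (x 1 / 2) +
      C₄ * Complex.exp (Complex.I / 2 * x 2) * Real.cos (x 1 / 2)‖ := by
    rw [← mul_one ‖_ + _‖, ← norm_exp_half (x 3), ← norm_mul, compP]
    congr 1
    ring
  have e2 : ‖compQ C₃ C₄ x‖ = ‖C₃ * Complex.exp (-(Complex.I / 2) * x 2) * Real.cos (x 1 / 2) +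
      C₄ * Complex.exp (Complex.I / 2 * x 2) * ((-Real.sin (x 1 / 2) : ℝ) : ℂ)‖ := by
    rw [← mul_one ‖_ + _‖, ← norm_exp_neg_half (x 3), ← norm_mul, compQ]
    congr 1
    ring
  rw [e1, e2, key _ _ _ _ (Real.sin_sq_add_cos_sq _), norm_mul, norm_mul, norm_exp_half,
    norm_exp_neg_half, mul_one, mul_one]

lemma spinorNormSq_uTN (C₃ C₄ : ℂ) (x : Coord) :
    spinorNormSq (uTN C₃ C₄ x) = ‖C₃‖ ^ 2 + ‖C₄‖ ^ 2 := by
  rw [uTN_eq, ← norm_compP_sq_add_norm_compQ_sq C₃ C₄ x]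
  simp [spinorNormSq, Fin.sum_univ_four]

lemma spinorNormSq_uNeg (C₃ C₄ : ℂ) (x : Coord) :
    spinorNormSq (uNeg C₃ C₄ x) = ‖C₃‖ ^ 2 + ‖C₄‖ ^ 2 := by
  rw [uNeg_eq, ← norm_compP_sq_add_norm_compQ_sq C₃ C₄ x]
  simp [spinorNormSq, Fin.sum_univ_four]

lemma spinorNormSq_smul (c : ℝ) (Ψ : Spinor) :
    spinorNormSq ((c : ℂ) • Ψ) = c ^ 2 * spinorNormSq Ψ := by
  simp [spinorNormSq, mul_pow, Finset.mul_sum]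

lemma vectorSpinorNormSq_sigmaTN (N : ℝ) (C₃ C₄ : ℂ) (x : Coord) :
    vectorSpinorNormSq (sigmaTN N (uTN C₃ C₄) x) =
      (1 / (x 0 + N) ^ 2) ^ 2 * (16 * (‖C₃‖ ^ 2 + ‖C₄‖ ^ 2)) := by
  rw [sigmaTN_eq, ← norm_compP_sq_add_norm_compQ_sq C₃ C₄ x]
  simp only [vectorSpinorNormSq, radialField, uTN_eq, matTN_mulVec, spinorNormSq_smul,
    ← Finset.mul_sum]
  congr 1
  simp [spinorNormSq, Fin.sum_univ_four, mul_pow]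
  ring

lemma vectorSpinorNormSq_sigmaNeg (N : ℝ) (C₃ C₄ : ℂ) (x : Coord) :
    vectorSpinorNormSq (sigmaNeg N (uNeg C₃ C₄) x) =
      (1 / ((x 0 - N) ^ (1 / 2 : ℝ) * (x 0 + N) ^ (5 / 2 : ℝ))) ^ 2 *
        (24 * (‖C₃‖ ^ 2 + ‖C₄‖ ^ 2)) := by
  rw [sigmaNeg_eq, ← norm_compP_sq_add_norm_compQ_sq C₃ C₄ x]
  simp only [vectorSpinorNormSq, radialField, uNeg_eq, matNeg_mulVec, spinorNormSq_smul,
    ← Finset.mul_sum]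
  congr 1
  simp [spinorNormSq, Fin.sum_univ_four, mul_pow]
  ring

/-! ### Integration -/

section Integration

variable {N M : ℝ} {f : ℝ → ℝ}

/-- The f² of dr² cancels the f⁻² of σ₃². The determinant is computed in coordinates, not through
the frame, so that θ = 0, where the frame is singular, is included. -/
lemma sqrt_det_metric (h : Profile N M f) {x : Coord} (hx : x ∈ fundamentalDomain N) :
    Real.sqrt (Matrix.of fun i j : Fin 4 =>
      metric N f x (Pi.single i 1) (Pi.single j 1)).det =
      2 * N * (x 0 ^ 2 - N ^ 2) * Real.sin (x 1) := by
  have hN := h.pos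
  have h0 := h.sub_pos hx.1
  have h2 := h.f_pos hx.1
  have h3 := Real.sin_nonneg_of_nonneg_of_le_pi hx.2.1.1 hx.2.1.2.le
  have h6 := Real.sin_sq_add_cos_sq (x 3)
  have : (Matrix.of fun i j : Fin 4 => metric N f x (Pi.single i 1) (Pi.single j 1)) =
      !![f (x 0) ^ 2, 0, 0, 0; 0, x 0 ^ 2 - N ^ 2, 0, 0;
        0, 0, (x 0 ^ 2 - N ^ 2) * Real.sin (x 1) ^ 2 +
            4 * N ^ 2 / f (x 0) ^ 2 * Real.cos (x 1) ^ 2,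
          4 * N ^ 2 / f (x 0) ^ 2 * Real.cos (x 1);
        0, 0, 4 * N ^ 2 / f (x 0) ^ 2 * Real.cos (x 1), 4 * N ^ 2 / f (x 0) ^ 2] := by
    ext i j
    fin_cases i <;> fin_cases j <;> simp [metric, sigma1, sigma2, sigma3]
    · linear_combination (x 0 ^ 2 - N ^ 2) * h6
    · right
      ring
    · right
      ring
    · linear_combination (x 0 ^ 2 - N ^ 2) * Real.sin (x 1) ^ 2 * h6
  have hdet : (Matrix.of fun i j : Fin 4 =>
      metric N f x (Pi.single i 1) (Pi.single j 1)).det =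
      (2 * N * (x 0 ^ 2 - N ^ 2) * Real.sin (x 1)) ^ 2 := by
    rw [this, Matrix.det_succ_row_zero]
    simp [Fin.sum_univ_succ, Matrix.det_fin_three]
    field_simp
    ring
  rw [hdet, Real.sqrt_sq (by positivity)]

lemma fundamentalDomain_eq (N : ℝ) : fundamentalDomain N = Set.univ.pi
    ![Set.Ioi N, Set.Ico 0 Real.pi, Set.Ico 0 (2 * Real.pi), Set.Ico 0 (4 * Real.pi)] := by
  ext x
  simp [fundamentalDomain, Fin.forall_fin_succ]

lemma measurableSet_fundamentalDomain (N : ℝ) : MeasurableSet (fundamentalDomain N) := by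
  rw [fundamentalDomain_eq]
  refine MeasurableSet.univ_pi fun i => ?_
  fin_cases i
  · exact measurableSet_Ioi
  all_goals exact measurableSet_Ico

lemma riemannianMeasure_eq (h : Profile N M f) : riemannianMeasure N f =
    (volume.restrict (fundamentalDomain N)).withDensity fun x =>
      ENNReal.ofReal (2 * N * (x 0 ^ 2 - N ^ 2) * Real.sin (x 1)) := by
  refine withDensity_congr_ae ?_
  filter_upwards [ae_restrict_mem (measurableSet_fundamentalDomain N)] with x hx
  rw [sqrt_det_metric h hx]

/-- Fubini on the fundamental domain for functions of the form `w(r) sin θ`. -/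
lemma lintegral_fundamentalDomain {w : ℝ → ℝ} (hw : ∀ r, N < r → 0 ≤ w r)
    (hi : IntegrableOn w (Set.Ioi N)) :
    ∫⁻ x in fundamentalDomain N, ENNReal.ofReal (w (x 0) * Real.sin (x 1)) =
      ENNReal.ofReal ((∫ r in Set.Ioi N, w r) * (16 * Real.pi ^ 2)) := by
  have hpi := Real.pi_pos
  let s : Fin 4 → Set ℝ :=
    ![Set.Ioi N, Set.Ico 0 Real.pi, Set.Ico 0 (2 * Real.pi), Set.Ico 0 (4 * Real.pi)]
  let g : Fin 4 → ℝ → ℝ := ![w, Real.sin, fun _ => 1, fun _ => 1]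
  have hg : ∀ i, Integrable (g i) (volume.restrict (s i)) := by
    intro i
    fin_cases i
    · exact hi
    · exact Real.continuous_sin.integrableOn_Icc.mono_set Set.Ico_subset_Icc_self
    · exact continuous_const.integrableOn_Icc.mono_set Set.Ico_subset_Icc_self
    · exact continuous_const.integrableOn_Icc.mono_set Set.Ico_subset_Icc_self
  have hprod : ∀ x : Coord, w (x 0) * Real.sin (x 1) = ∏ i, g i (x i) := by
    intro x
    simp [g, Fin.prod_univ_four]
  have hm : (volume : Measure Coord).restrict (fundamentalDomain N) =
      Measure.pi fun i => volume.restrict (s i) := by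
    rw [fundamentalDomain_eq, volume_pi, Measure.restrict_pi_pi]
  have hnn : 0 ≤ᵐ[volume.restrict (fundamentalDomain N)] fun x : Coord => ∏ i, g i (x i) := by
    filter_upwards [ae_restrict_mem (measurableSet_fundamentalDomain N)] with x hx
    rw [← hprod]
    exact mul_nonneg (hw _ hx.1) (Real.sin_nonneg_of_nonneg_of_le_pi hx.2.1.1 hx.2.1.2.le)
  simp only [hprod]
  rw [← ofReal_integral_eq_lintegral_ofReal (by rw [hm]; exact Integrable.fintype_prod hg) hnn,
    hm, integral_fintype_prod_eq_prod, Fin.prod_univ_four]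
  congr 1
  -- The angular factor is 2 · 2π · 4π = 16π².
  have e1 : ∫ t in s 1, g 1 t = 2 := by
    change ∫ t in Set.Ico 0 Real.pi, Real.sin t = 2
    rw [integral_Ico_eq_integral_Ioc, ← intervalIntegral.integral_of_le hpi.le, integral_sin]
    norm_num
  have e2 : ∫ t in s 2, g 2 t = 2 * Real.pi := by
    change ∫ t in Set.Ico 0 (2 * Real.pi), (1 : ℝ) = 2 * Real.pi
    simp [hpi.le]
  have e3 : ∫ t in s 3, g 3 t = 4 * Real.pi := by
    change ∫ t in Set.Ico 0 (4 * Real.pi), (1 : ℝ) = 4 * Real.pi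
    simp [hpi.le]
  rw [e1, e2, e3]
  change (∫ r in Set.Ioi N, w r) * _ * _ * _ = _
  ring

/-- The squared `L²` norm of a field with radial norm, through an antiderivative `W`. -/
lemma L2NormSq_eq (h : Profile N M f) {σ : Coord → VectorSpinor} {w W : ℝ → ℝ}
    (hσ : ∀ x ∈ fundamentalDomain N,
      2 * N * (x 0 ^ 2 - N ^ 2) * vectorSpinorNormSq (σ x) = w (x 0))
    (hw : ∀ r, N < r → 0 ≤ w r) (hW : ∀ r, N ≤ r → HasDerivAt W (w r) r)
    (hlim : Filter.Tendsto W Filter.atTop (nhds 0)) :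
    L2NormSq N f σ = ENNReal.ofReal (-W N * (16 * Real.pi ^ 2)) := by
  have hN := h.pos
  -- Integrability is not assumed: it follows from w ≥ 0 and the limit of W at infinity.
  have hi : IntegrableOn w (Set.Ioi N) :=
    integrableOn_Ioi_deriv_of_nonneg' (fun r hr => hW r hr) (fun r hr => hw r hr) hlim
  have hint : ∫ r in Set.Ioi N, w r = -W N := by
    rw [integral_Ioi_of_hasDerivAt_of_nonneg' (fun r hr => hW r hr) (fun r hr => hw r hr) hlim,
      zero_sub]
  rw [← hint, ← lintegral_fundamentalDomain hw hi, L2NormSq, riemannianMeasure_eq h,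
    lintegral_withDensity_eq_lintegral_mul_non_measurable _ (by fun_prop)
      (Filter.Eventually.of_forall fun _ => ENNReal.ofReal_lt_top)]
  refine setLIntegral_congr_fun (measurableSet_fundamentalDomain N) fun x hx => ?_
  have h0 := h.sub_pos hx.1
  have h1 := Real.sin_nonneg_of_nonneg_of_le_pi hx.2.1.1 hx.2.1.2.le
  simp only [Pi.mul_apply]
  rw [← ENNReal.ofReal_mul (by positivity), ← hσ x hx]
  congr 1
  ring

lemma aestronglyMeasurable_radialField {φ : ℝ → ℝ} (hφ : Measurable φ) {u : Coord → Spinor}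
    (hu : Continuous u) (A : Fin 4 → Matrix (Fin 4) (Fin 4) ℂ) (μ : Measure Coord) :
    AEStronglyMeasurable (radialField φ A u) μ := by
  refine Measurable.aestronglyMeasurable ?_
  refine measurable_pi_lambda _ fun i => ?_
  have h1 : Measurable fun x => A i *ᵥ u x := (continuous_const.matrix_mulVec hu).measurable
  have h2 : Measurable fun x : Coord => (φ (x 0) : ℂ) := by fun_prop
  exact h2.smul h1

lemma L2NormSq_sigmaTN (hN : 0 < N) (C₃ C₄ : ℂ) :
    L2NormSq N (fTN N) (sigmaTN N (uTN C₃ C₄)) =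
      ENNReal.ofReal (128 * Real.pi ^ 2 * (‖C₃‖ ^ 2 + ‖C₄‖ ^ 2)) := by
  rw [L2NormSq_eq (profile_fTN hN)
    -- The coefficient is 2N times the 16 of |σ|². The antiderivative vanishes at infinity and
    -- equals -8 |u|² at r = N.
    (w := fun r => 32 * N * (‖C₃‖ ^ 2 + ‖C₄‖ ^ 2) * ((r - N) / (r + N) ^ 3))
    (W := fun r => 32 * N * (‖C₃‖ ^ 2 + ‖C₄‖ ^ 2) * (N * ((r + N)⁻¹) ^ 2 - (r + N)⁻¹))]
  · congr 1
    field_simp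
    ring
  · intro x hx
    have : 0 < x 0 + N := by linarith [hx.1]
    rw [vectorSpinorNormSq_sigmaTN]
    field_simp
    ring
  · intro r hr
    have h1 : 0 < r - N := sub_pos.2 hr
    have h2 : 0 < r + N := by linarith
    positivity
  · intro r hr
    have h2 : 0 < r + N := by linarith
    have h3 := ((hasDerivAt_id r).add_const N).inv h2.ne'
    refine ((((h3.pow 2).const_mul N).sub h3).const_mul _).congr_deriv ?_
    congr 1
    simp
    field_simp
    ring
  · have h1 : Filter.Tendsto (fun r : ℝ => (r + N)⁻¹) Filter.atTop (nhds 0) :=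
      tendsto_inv_atTop_zero.comp (Filter.tendsto_atTop_add_const_right _ N Filter.tendsto_id)
    simpa using (((h1.pow 2).const_mul N).sub h1).const_mul (32 * N * (‖C₃‖ ^ 2 + ‖C₄‖ ^ 2))

/-- The singularity 1 / (r - N) of |σ|² is absorbed by the volume density, leaving 48N |u|² / (r +
N)⁴, whose integral over r > N is 2 |u|² / N². -/
lemma L2NormSq_sigmaNeg (hN : 0 < N) (C₃ C₄ : ℂ) :
    L2NormSq N (fNeg N) (sigmaNeg N (uNeg C₃ C₄)) =
      ENNReal.ofReal (32 * Real.pi ^ 2 / N ^ 2 * (‖C₃‖ ^ 2 + ‖C₄‖ ^ 2)) := by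
  rw [L2NormSq_eq (profile_fNeg hN)
    (w := fun r => 48 * N * (‖C₃‖ ^ 2 + ‖C₄‖ ^ 2) * (1 / (r + N) ^ 4))
    (W := fun r => (-16 * N * (‖C₃‖ ^ 2 + ‖C₄‖ ^ 2)) * ((r + N)⁻¹) ^ 3)]
  · congr 1
    field_simp
    ring
  · intro x hx
    have h1 : 0 < x 0 - N := sub_pos.2 hx.1
    have h2 : 0 < x 0 + N := by linarith
    have h3 : ((x 0 - N) ^ (1 / 2 : ℝ)) ^ 2 = x 0 - N := by
      rw [← Real.rpow_natCast, ← Real.rpow_mul h1.le]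
      norm_num
    have h4 : ((x 0 + N) ^ (5 / 2 : ℝ)) ^ 2 = (x 0 + N) ^ 5 := by
      rw [← Real.rpow_natCast, ← Real.rpow_mul h2.le, ← Real.rpow_natCast]
      norm_num
    rw [vectorSpinorNormSq_sigmaNeg, div_pow, mul_pow, h3, h4]
    field_simp
    ring
  · intro r hr
    have h2 : 0 < r + N := by linarith
    positivity
  · intro r hr
    have h2 : 0 < r + N := by linarith
    refine (((((hasDerivAt_id r).add_const N).inv h2.ne').pow 3).const_mul _).congr_deriv ?_
    simp
    field_simp
    ring
  · have h1 : Filter.Tendsto (fun r : ℝ => (r + N)⁻¹) Filter.atTop (nhds 0) :=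
      tendsto_inv_atTop_zero.comp (Filter.tendsto_atTop_add_const_right _ N Filter.tendsto_id)
    have h2 := (h1.pow 3).const_mul (-16 * N * (‖C₃‖ ^ 2 + ‖C₄‖ ^ 2))
    rwa [zero_pow three_ne_zero, mul_zero] at h2

lemma isL2_sigmaTN (hN : 0 < N) (C₃ C₄ : ℂ) :
    IsL2 N (fTN N) (sigmaTN N (uTN C₃ C₄)) := by
  refine ⟨?_, (L2NormSq_sigmaTN hN C₃ C₄).trans_lt ENNReal.ofReal_lt_top⟩
  rw [sigmaTN_eq]
  have hu : Differentiable ℝ (uTN C₃ C₄) := differentiableAt_uTN C₃ C₄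
  exact aestronglyMeasurable_radialField (by fun_prop) hu.continuous _ _

lemma isL2_sigmaNeg (hN : 0 < N) (C₃ C₄ : ℂ) :
    IsL2 N (fNeg N) (sigmaNeg N (uNeg C₃ C₄)) := by
  refine ⟨?_, (L2NormSq_sigmaNeg hN C₃ C₄).trans_lt ENNReal.ofReal_lt_top⟩
  rw [sigmaNeg_eq]
  have hu : Differentiable ℝ (uNeg C₃ C₄) := differentiableAt_uNeg C₃ C₄
  exact aestronglyMeasurable_radialField (by fun_prop) hu.continuous _ _

end Integration

end TaubNUT

end

theorem theorem4p3 (N : ℝ) (hN : 0 < N) (C₃ C₄ : ℂ) :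
    -- the Taub-NUT metric
    ((TaubNUT.IsParallelSpinor N (TaubNUT.fTN N) (TaubNUT.uTN C₃ C₄) ∧
        ∀ x, TaubNUT.spinorNormSq (TaubNUT.uTN C₃ C₄ x) = ‖C₃‖ ^ 2 + ‖C₄‖ ^ 2) ∧
      TaubNUT.IsRaritaSchwingerField N (TaubNUT.fTN N)
        (TaubNUT.sigmaTN N (TaubNUT.uTN C₃ C₄)) ∧
      TaubNUT.IsL2 N (TaubNUT.fTN N) (TaubNUT.sigmaTN N (TaubNUT.uTN C₃ C₄)) ∧
      TaubNUT.L2NormSq N (TaubNUT.fTN N) (TaubNUT.sigmaTN N (TaubNUT.uTN C₃ C₄)) =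
        ENNReal.ofReal (128 * Real.pi ^ 2 * (‖C₃‖ ^ 2 + ‖C₄‖ ^ 2))) ∧
    -- the Taub-NUT metric with negative NUT charge
    ((TaubNUT.IsParallelSpinor N (TaubNUT.fNeg N) (TaubNUT.uNeg C₃ C₄) ∧
        ∀ x, TaubNUT.spinorNormSq (TaubNUT.uNeg C₃ C₄ x) = ‖C₃‖ ^ 2 + ‖C₄‖ ^ 2) ∧
      TaubNUT.IsRaritaSchwingerField N (TaubNUT.fNeg N)
        (TaubNUT.sigmaNeg N (TaubNUT.uNeg C₃ C₄)) ∧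
      TaubNUT.IsL2 N (TaubNUT.fNeg N) (TaubNUT.sigmaNeg N (TaubNUT.uNeg C₃ C₄)) ∧
      TaubNUT.L2NormSq N (TaubNUT.fNeg N) (TaubNUT.sigmaNeg N (TaubNUT.uNeg C₃ C₄)) =
        ENNReal.ofReal (32 * Real.pi ^ 2 / N ^ 2 * (‖C₃‖ ^ 2 + ‖C₄‖ ^ 2))) := by
  refine ⟨⟨⟨TaubNUT.isParallelSpinor_uTN hN C₃ C₄, TaubNUT.spinorNormSq_uTN C₃ C₄⟩,
      TaubNUT.isRaritaSchwingerField_sigmaTN C₃ C₄ hN, TaubNUT.isL2_sigmaTN hN C₃ C₄,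
      TaubNUT.L2NormSq_sigmaTN hN C₃ C₄⟩,
    ⟨TaubNUT.isParallelSpinor_uNeg hN C₃ C₄, TaubNUT.spinorNormSq_uNeg C₃ C₄⟩,
    TaubNUT.isRaritaSchwingerField_sigmaNeg C₃ C₄ hN, TaubNUT.isL2_sigmaNeg hN C₃ C₄,
    TaubNUT.L2NormSq_sigmaNeg hN C₃ C₄⟩
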